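/- Let $H \in \mathbb{R}[\partial]^{n\times q}$ define a controllable system $H(\partial) z = 0$ of linear ordinary differential equations with constant coefficients (any smooth trajectory on $\mathbb{R}$ can be steered in finite time to any other one). Let $QHV = D$ be a Smith normal form, with $Q \in \mathbb{R}[\partial]^{n\times n}$ and $V \in \mathbb{R}[\partial]^{q\times q}$ invertible over $\mathbb{R}[\partial]$, and let $P \in \mathbb{R}[\partial]^{q\times p}$ consist of the columns of $V$ that belong to zero columns of $D$. Let $h$ be the order of $P$, i.e. the largest degree of its entries. Let $S \subseteq \mathbb{R}$ be a non-degenerate interval (bounded or not, containing its endpoints or not) and $m \in \mathbb{N}_0$. Let $\mathrm{sol}_{C^m}(H)$ be the set of all $z \in C^m(S,\mathbb{R}^q)$ with $H(\partial)z = 0$ in the sense of distributions on the interior of $S$, with the topology of $C^m(S,\mathbb{R}^q)$ (uniform convergence on compact subsets of $S$ of the derivatives of order at most $m$). Let $r \in \mathbb{N}_0$, $\nu = r + \tfrac12$, $\sigma_f, \ell > 0$, let $$k_\nu(t,t') = \sigma_f^2 \exp\Bigl(-\tfrac{\sqrt{2r+1}\,|t-t'|}{\ell}\Bigr)\frac{r!}{(2r)!}\sum_{i=0}^r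 \frac{(r+i)!}{i!\,(r-i)!}\Bigl(\tfrac{2\sqrt{2r+1}\,|t-t'|}{\ell}\Bigr)^{r-i}$$ be the Matérn kernel, and let $\mathcal{H}_{k_\nu}$ be its reproducing kernel Hilbert space of functions on $S$. If $\nu \ge m + h + \tfrac12$, then $P\cdot(\mathcal{H}_{k_\nu})^p$ is contained and dense in $\mathrm{sol}_{C^m}(H)$. Moreover, for every noise variance $v > 0$, the posterior mean functions $K_*^\top (K + vI)^{-1} y$ of the LODE-GP, i.e. of the Gaussian process with mean $0$ and covariance function $P\, k_\nu \hat P^\top$ (where $\hat P$ acts on the second argument), for arbitrary finite data with times in $S$ and values in $\mathbb{R}^q$, also form a dense subset of $\mathrm{sol}_{C^m}(H)$. -/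

import Mathlib

noncomputable section

namespace LodeGP

open Polynomial

/-! ### Linear differential operators with constant coefficients -/

/-- `p(∂) f` at the point `t`, for a function `f` considered on the set `S` (derivatives within `S`;
for `S = univ` these are the ordinary derivatives). -/
def diffOp (S : Set ℝ) (p : Polynomial ℝ) (f : ℝ → ℝ) (t : ℝ) : ℝ :=
  p.sum fun k a => a * iteratedDerivWithin k f S t

/-- A function on `S`, extended by zero to `ℝ`. All uses below depend on the values on `S` only. -/
def ext {S : Set ℝ} (f : S → ℝ) : ℝ → ℝ := Function.extend Subtype.val f 0

/-- `P(∂) f` for a matrix `P` over `ℝ[∂]` and a vector `f` of functions on `S`. -/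
def applyOp {S : Set ℝ} {q : ℕ} {ι : Type} [Fintype ι] (P : Matrix (Fin q) ι (Polynomial ℝ))
    (f : ι → S → ℝ) : S → Fin q → ℝ :=
  fun t j => ∑ i, diffOp S (P j i) (ext (f i)) t

/-- The order of the operator matrix `P`: the largest degree of its entries. -/
def opOrder {q : ℕ} {ι : Type} [Fintype ι] (P : Matrix (Fin q) ι (Polynomial ℝ)) : ℕ :=
  Finset.univ.sup fun j => Finset.univ.sup fun i => (P j i).natDegree

/-! ### Smith normal form and the parametrization -/

/-- `Q * H * V = D` with `Q`, `V` invertible over `ℝ[∂]` and `D` in Smith normal form: (rectangular)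
diagonal, each diagonal entry dividing the later ones. -/
structure IsSmithForm {n q : ℕ} (H : Matrix (Fin n) (Fin q) (Polynomial ℝ))
    (Q : Matrix (Fin n) (Fin n) (Polynomial ℝ)) (V : Matrix (Fin q) (Fin q) (Polynomial ℝ))
    (D : Matrix (Fin n) (Fin q) (Polynomial ℝ)) : Prop where
  isUnit_left : IsUnit Q
  isUnit_right : IsUnit V
  eq : Q * H * V = D
  diagonal : ∀ (i : Fin n) (j : Fin q), (i : ℕ) ≠ (j : ℕ) → D i j = 0
  dvd : ∀ (i i' : Fin n) (j j' : Fin q), (i : ℕ) = (j : ℕ) → (i' : ℕ) = (j' : ℕ) → i ≤ i' →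
    D i j ∣ D i' j'

/-- The indices of the zero columns of `D` (for diagonal `D`: the columns whose diagonal entry is
zero, or which lie to the right of the last diagonal position). -/
def ZeroCol {n q : ℕ} (D : Matrix (Fin n) (Fin q) (Polynomial ℝ)) : Type :=
  {j : Fin q // ∀ i, D i j = 0}

instance {n q : ℕ} (D : Matrix (Fin n) (Fin q) (Polynomial ℝ)) : Fintype (ZeroCol D) :=
  @Fintype.ofFinite _ (inferInstanceAs (Finite {j : Fin q // ∀ i, D i j = 0}))

/-- The columns of `V` that belong to the zero columns of `D`. -/
def parametrization {n q : ℕ} (V : Matrix (Fin q) (Fin q) (Polynomial ℝ))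
    (D : Matrix (Fin n) (Fin q) (Polynomial ℝ)) : Matrix (Fin q) (ZeroCol D) (Polynomial ℝ) :=
  fun i j => V i j.1

/-! ### Solutions and controllability -/

/-- Smooth trajectories on `ℝ` of the system `H(∂) w = 0`. -/
def IsTrajectory {n q : ℕ} (H : Matrix (Fin n) (Fin q) (Polynomial ℝ)) (w : ℝ → Fin q → ℝ) :
    Prop :=
  ContDiff ℝ (⊤ : ℕ∞) w ∧ ∀ i t, ∑ j, diffOp Set.univ (H i j) (fun s => w s j) t = 0

/-- Controllability of the system `H(∂) w = 0`: any past trajectory can be steered, in finite time,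
to any future trajectory. -/
def IsControllable {n q : ℕ} (H : Matrix (Fin n) (Fin q) (Polynomial ℝ)) : Prop :=
  ∀ w₁ w₂ : ℝ → Fin q → ℝ, IsTrajectory H w₁ → IsTrajectory H w₂ →
    ∃ T > 0, ∃ w : ℝ → Fin q → ℝ, IsTrajectory H w ∧
      (∀ t < 0, w t = w₁ t) ∧ ∀ t ≥ T, w t = w₂ (t - T)

/-- The space `C^m(S, ℝ^q)`. -/
def CmSpace (S : Set ℝ) (m q : ℕ) : Type :=
  {z : S → Fin q → ℝ // ∀ j, ContDiffOn ℝ m (ext fun t => z t j) S}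

/-- The usual topology of `C^m(S, ℝ^q)`: uniform convergence, on the compact subsets of `S`, of the
derivatives of order at most `m`. -/
instance (S : Set ℝ) (m q : ℕ) : TopologicalSpace (CmSpace S m q) :=
  TopologicalSpace.induced
    (fun z (k : Fin (m + 1)) (j : Fin q) =>
      UniformOnFun.ofFun {K : Set S | IsCompact K}
        fun t : S => iteratedDerivWithin (k : ℕ) (ext fun s => z.1 s j) S t)
    inferInstance

/-- `sol_{C^m}(H)` on `S`: the `z` of class `C^m` with `H(∂) z = 0` in the sense of distributions
on the interior of `S` (the formal adjoint of `p(∂)` is `p(-∂)`). -/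
def sol (S : Set ℝ) (m : ℕ) {n q : ℕ} (H : Matrix (Fin n) (Fin q) (Polynomial ℝ)) :
    Set (CmSpace S m q) :=
  {z | ∀ φ : ℝ → ℝ, ContDiff ℝ (⊤ : ℕ∞) φ → HasCompactSupport φ → tsupport φ ⊆ interior S →
    ∀ i, ∑ j, ∫ t : ℝ, ext (fun s => z.1 s j) t *
      diffOp Set.univ ((H i j).comp (-Polynomial.X)) φ t = 0}

/-- The set `A` of functions consists of elements of `B ⊆ C^m(S, ℝ^q)` and is dense in `B`. -/
def IsDenseIn {S : Set ℝ} {m q : ℕ} (A : Set (S → Fin q → ℝ)) (B : Set (CmSpace S m q)) : Prop :=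
  (∀ a ∈ A, ∃ w ∈ B, w.1 = a) ∧ B ⊆ closure {w | w.1 ∈ A}

/-! ### Matérn kernels, their RKHS, and the LODE-GP -/

/-- The Matérn kernel `k_ν` with `ν = r + 1/2`, signal variance `σ ^ 2` and length scale `ℓ`. -/
def matern (σ ℓ : ℝ) (r : ℕ) (s t : ℝ) : ℝ :=
  σ ^ 2 * Real.exp (-(Real.sqrt (2 * r + 1) * |s - t| / ℓ)) *
    ((r.factorial : ℝ) / ((2 * r).factorial : ℝ) *
      ∑ i ∈ Finset.range (r + 1),
        ((r + i).factorial : ℝ) / ((i.factorial : ℝ) * ((r - i).factorial : ℝ)) *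
          (2 * Real.sqrt (2 * r + 1) * |s - t| / ℓ) ^ (r - i))

/-- The functions on `T` that belong to the (unique) reproducing kernel Hilbert space with
kernel `k`. -/
def rkhs {T : Type} (k : T → T → ℝ) : Set (T → ℝ) :=
  {f | ∃ (E : Type) (_ : NormedAddCommGroup E) (_ : InnerProductSpace ℝ E) (_ : CompleteSpace E)
    (_ : RKHS ℝ E T ℝ), (∀ s t, RKHS.kernel E s t 1 = k s t) ∧ ∃ g : E, ⇑g = f}

/-- The image `P · (𝓗_k)^p` of the product of copies of the RKHS of `k` on `S`. -/
def opImage (S : Set ℝ) {q : ℕ} {ι : Type} [Fintype ι] (P : Matrix (Fin q) ι (Polynomial ℝ))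
    (k : ℝ → ℝ → ℝ) : Set (S → Fin q → ℝ) :=
  {w | ∃ f : ι → S → ℝ, (∀ i, f i ∈ rkhs fun s t : S => k s t) ∧ w = applyOp P f}

/-- The matrix-valued covariance function `P · (k I) · P̂ᵀ` of the LODE-GP `P g̃`, where `g̃` has
independent components with covariance function `k` and `P̂` acts on the second argument. -/
def lodeKernel {q : ℕ} {ι : Type} [Fintype ι] (P : Matrix (Fin q) ι (Polynomial ℝ))
    (k : ℝ → ℝ → ℝ) (s t : ℝ) : Matrix (Fin q) (Fin q) ℝ :=
  fun j l => ∑ i, diffOp Set.univ (P j i)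
    (fun s' => diffOp Set.univ (P l i) (fun t' => k s' t') t) s

/-- The posterior mean functions on `S` of the Gaussian process with mean zero and matrix-valued
covariance function `K`, for arbitrary finite data `(τ a, y a)` in `S × ℝ^q` with Gaussian noise of
variance `v`: the functions `K_*ᵀ (K + v I)⁻¹ y`. -/
def posteriorMeans (S : Set ℝ) {q : ℕ} (K : ℝ → ℝ → Matrix (Fin q) (Fin q) ℝ) (v : ℝ) :
    Set (S → Fin q → ℝ) :=
  {μ | ∃ (N : ℕ) (τ : Fin N → S) (y : Fin N × Fin q → ℝ), ∀ (t : S) (j : Fin q),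
    μ t j = ∑ a : Fin N × Fin q, K t (τ a.1) j a.2 *
      (((Matrix.of fun b c : Fin N × Fin q => K (τ b.1) (τ c.1) b.2 c.2) +
        v • (1 : Matrix (Fin N × Fin q) (Fin N × Fin q) ℝ))⁻¹.mulVec y) a}

end LodeGP

end

/-!
The solutions are parametrized by the matrix `P` of columns of `V`, of order `h`, and everything
reduces to approximating solutions by functions `P(∂) γ` with `γ` smooth of compact support.

*Parametrization.* If a diagonal entry `d` of the Smith form were not constant, a nonzero solution
of `d(∂) y = 0`, transported by `V`, would be a trajectory that cannot be steered to zero; hence for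
a controllable system the nonzero diagonal entries are units (`isUnit_of_isControllable`). It
follows that on a bounded interval every distributional solution is `P(∂) g` for some vector `g` of
distributions (`exists_eq_polyAct_parametrization`).

*Regularity.* The vector `g` need not consist of functions of class `C^(m + h)`, and for given `z`
it is unique, so regularity has to come from a better choice of `P`. As `P` has a left inverse, it
can be multiplied by a unimodular matrix so that its leading column coefficients become independent
(`exists_column_reduced`). For a parametrization with column degrees `d i` of this kind, a bootstrap
in the scale of negative and positive orders of differentiability shows that a solution of class
`C^m` comes from functions `f i` of class `C^(m + d i)` (`exists_regular_preimage`). Such functions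
are approximated with all these derivatives by smooth functions with compact support, and undoing
the change of the parametrization keeps smoothness and compact support
(`exists_polyDiff_approx_of_mem_sol`).

*Matérn kernels.* The Matérn kernel is the Gram kernel of the feature map
`Φ t = c • (x ↦ (t - x)₊ ^ r * exp (-α * (t - x)))` with values in `L²(ℝ)`
(`inner_maternFeature`). The map `Φ` is of class `C^r`, and by Taylor's formula with integral
remainder every smooth function with compact support is of the form `⟪g, Φ ·⟫`
(`exists_inner_maternFeature_eq`), so it belongs to the RKHS. The condition on `ν` says
`m + h ≤ r`, so that `P(∂) Φ` is of class `C^m`. This gives inclusion, because `H * P = 0`, and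
density of `P(∂)` of the RKHS.

*Posterior means.* As `K + v I` is invertible, the posterior means are exactly the functions
represented by finite linear combinations of the features `(P(∂) Φ) t`, `t ∈ S`
(`mem_posteriorMeans_iff`). For a function represented by `G`, only the orthogonal projection of `G`
to the closed span of these features matters, and approximating this projection in norm approximates
the function in `C^m` (`mem_closure_featureImage_span`).
-/

noncomputable section

namespace LodeGP

open Polynomial Set Filter Topology MeasureTheory

/-! ### Polynomial matrices acting on vectors, and column reduction -/

section Algebra

variable {M : Type*} [AddCommGroup M] [Module ℝ M]

/-- The action of a matrix over `ℝ[X]` on vectors with entries in a real vector space `M`, where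
the indeterminate acts on `M` as the endomorphism `E`. -/
def polyAct {ι κ : Type*} [Fintype κ] (E : Module.End ℝ M) (A : Matrix ι κ ℝ[X]) (x : κ → M) :
    ι → M :=
  fun i => ∑ j, aeval E (A i j) (x j)

theorem polyAct_mul {ι κ μ : Type*} [Fintype κ] [Fintype μ] (E : Module.End ℝ M)
    (A : Matrix ι κ ℝ[X]) (B : Matrix κ μ ℝ[X]) (x : μ → M) :
    polyAct E (A * B) x = polyAct E A (polyAct E B x) := by
  funext i
  simp only [polyAct, Matrix.mul_apply, map_sum, map_mul, LinearMap.sum_apply, Module.End.mul_apply]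
  exact Finset.sum_comm

theorem polyAct_one {ι : Type*} [Fintype ι] [DecidableEq ι] (E : Module.End ℝ M) (x : ι → M) :
    polyAct E (1 : Matrix ι ι ℝ[X]) x = x := by
  funext i
  simp only [polyAct, Matrix.one_apply]
  rw [Finset.sum_eq_single i]
  · simp
  · intro j _ hj
    simp [hj.symm]
  · simp

theorem polyAct_zero_left {ι κ : Type*} [Fintype κ] (E : Module.End ℝ M) (x : κ → M) :
    polyAct E (0 : Matrix ι κ ℝ[X]) x = 0 := by
  funext i
  simp [polyAct]

theorem polyAct_zero_right {ι κ : Type*} [Fintype κ] (E : Module.End ℝ M) (A : Matrix ι κ ℝ[X]) :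
    polyAct E A (0 : κ → M) = 0 := by
  funext i
  simp [polyAct]

end Algebra

/-- Column reduction: for a matrix `P` over `ℝ[X]` with a left inverse there is a unimodular `W`
such that `P * W` has linearly independent leading column coefficients. The independence is
expressed by a real left inverse `L` of the matrix of the coefficients of degree `d i` in
column `i`. -/
theorem exists_column_reduced {q : ℕ} {ι : Type} [Fintype ι] [DecidableEq ι]
    (P : Matrix (Fin q) ι ℝ[X]) (U : Matrix ι (Fin q) ℝ[X]) (hU : U * P = 1) :
    ∃ (W : Matrix ι ι ℝ[X]) (d : ι → ℕ) (L : Matrix ι (Fin q) ℝ), IsUnit W ∧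
      (∀ j i, ((P * W) j i).natDegree ≤ d i) ∧
      ∀ i i', ∑ j, L i j * ((P * W) j i').coeff (d i') = if i = i' then 1 else 0 := by
  classical
  -- a choice of `W` and `d` for which the sum of the column degrees is minimal
  let p : ℕ → Prop := fun n => ∃ (W : Matrix ι ι ℝ[X]) (d : ι → ℕ), IsUnit W ∧
    (∀ j i, ((P * W) j i).natDegree ≤ d i) ∧ ∑ i, d i = n
  have hp : ∃ n, p n := by
    refine ⟨_, 1, fun i => Finset.univ.sup fun j => (P j i).natDegree, isUnit_one, ?_, rfl⟩
    intro j i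
    rw [Matrix.mul_one]
    exact Finset.le_sup (f := fun j => (P j i).natDegree) (Finset.mem_univ j)
  obtain ⟨W, d, hW, hd, hn⟩ := Nat.find_spec hp
  have hmin : ∀ n, p n → Nat.find hp ≤ n := fun n h => Nat.find_min' hp h
  let C : Matrix (Fin q) ι ℝ := fun j i => ((P * W) j i).coeff (d i)
  have hinj : LinearMap.ker C.mulVecLin = ⊥ := by
    rw [LinearMap.ker_eq_bot']
    intro c hc
    by_contra hc0
    have hne : (Finset.univ.filter fun i => c i ≠ 0).Nonempty := by
      by_contra h
      rw [Finset.not_nonempty_iff_eq_empty, Finset.filter_eq_empty_iff] at h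
      exact hc0 (funext fun i => by simpa using h (Finset.mem_univ i))
    obtain ⟨i₀, hi₀, hmax⟩ := Finset.exists_max_image _ d hne
    simp only [Finset.mem_filter, Finset.mem_univ, true_and] at hi₀ hmax
    -- the combination of the columns that cancels the leading coefficients
    let v : ι → ℝ[X] := fun i => Polynomial.C (c i) * X ^ (d i₀ - d i)
    have hv : ∀ j, ((P * W).mulVec v) j =
        ∑ i, (P * W) j i * (Polynomial.C (c i) * X ^ (d i₀ - d i)) := fun j => rfl
    have hdeg : ∀ j, (((P * W).mulVec v) j).natDegree ≤ d i₀ := by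
      intro j
      rw [hv]
      refine natDegree_sum_le_of_forall_le _ _ fun i _ => ?_
      by_cases h : c i = 0
      · simp [h]
      · refine natDegree_mul_le.trans ?_
        have h1 := natDegree_C_mul_X_pow_le (c i) (d i₀ - d i)
        have h2 := hd j i
        have h3 := hmax i h
        omega
    have hcoeff : ∀ j, (((P * W).mulVec v) j).coeff (d i₀) = 0 := by
      intro j
      rw [hv, finsetSum_coeff]
      refine Eq.trans ?_ (congrFun hc j)
      refine Finset.sum_congr rfl fun i _ => ?_
      by_cases h : c i = 0
      · simp [h]
      · have h3 := hmax i h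
        have h4 : d i₀ = d i + (d i₀ - d i) := by omega
        rw [mul_left_comm, coeff_C_mul]
        conv_lhs => rw [h4]
        rw [show d i + (d i₀ - d i) - d i = d i₀ - d i by omega, coeff_mul_X_pow, mul_comm]
    -- in degree zero the combination vanishes, against the left inverse; otherwise replacing
    -- column `i₀` by it lowers the sum of the degrees
    by_cases hd0 : d i₀ = 0
    · have h0 : (P * W).mulVec v = 0 := by
        funext j
        have h1 := hdeg j
        rw [hd0, Nat.le_zero] at h1
        have h2 := hcoeff j
        rw [hd0] at h2
        rw [eq_C_of_natDegree_eq_zero h1, h2]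
        simp
      obtain ⟨W', hW'⟩ := hW
      have h1 : v = 0 := by
        have : ((↑W'⁻¹ : Matrix ι ι ℝ[X]) * U * (P * W)) = 1 := by
          rw [Matrix.mul_assoc, ← Matrix.mul_assoc U, hU, Matrix.one_mul, ← hW', Units.inv_mul]
        rw [← Matrix.one_mulVec v, ← this, ← Matrix.mulVec_mulVec, h0, Matrix.mulVec_zero]
      have h2 := congrFun h1 i₀
      simp only [v, Nat.sub_self, pow_zero, mul_one, Pi.zero_apply, C_eq_zero] at h2
      exact hi₀ h2
    · let E : Matrix ι ι ℝ[X] := (1 : Matrix ι ι ℝ[X]).updateCol i₀ v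
      have hE : IsUnit E := by
        rw [Matrix.isUnit_iff_isUnit_det]
        have : E.det = v i₀ := by
          have h := Matrix.cramer_apply (1 : Matrix ι ι ℝ[X]) v i₀
          rw [Matrix.cramer_one] at h
          exact h.symm
        rw [this]
        simp only [v, Nat.sub_self, pow_zero, mul_one]
        exact (isUnit_iff_ne_zero.mpr hi₀).map Polynomial.C
      have hPE : ∀ j i, (P * (W * E)) j i =
          if i = i₀ then ((P * W).mulVec v) j else (P * W) j i := by
        intro j i
        rw [← Matrix.mul_assoc]
        simp only [E, Matrix.mul_updateCol]
        by_cases h : i = i₀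
        · subst h
          simp
        · simp [h]
      have hlt : ∑ i, Function.update d i₀ (d i₀ - 1) i < ∑ i, d i := by
        refine Finset.sum_lt_sum (fun i _ => ?_) ⟨i₀, Finset.mem_univ _, ?_⟩
        · by_cases h : i = i₀
          · subst h; simp
          · simp [h]
        · simp only [Function.update_self]
          omega
      have hle := hmin _ ⟨W * E, Function.update d i₀ (d i₀ - 1), hW.mul hE, ?_, rfl⟩
      · omega
      · intro j i
        rw [hPE]
        by_cases h : i = i₀
        · subst h
          simp only [if_true, Function.update_self]
          refine natDegree_le_iff_coeff_eq_zero.mpr fun N hN => ?_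
          rcases eq_or_lt_of_le (show d i ≤ N by omega) with h | h
          · rw [← h]; exact hcoeff j
          · exact coeff_eq_zero_of_natDegree_lt ((hdeg j).trans_lt h)
        · simp only [h, if_false, ne_eq, not_false_eq_true, Function.update_of_ne]
          exact hd j i
  obtain ⟨g, hg⟩ := C.mulVecLin.exists_leftInverse_of_injective hinj
  refine ⟨W, d, LinearMap.toMatrix' g, hW, hd, fun i i' => ?_⟩
  have h1 : LinearMap.toMatrix' g * C = 1 := by
    have := congrArg LinearMap.toMatrix' hg
    rw [LinearMap.toMatrix'_comp, LinearMap.toMatrix'_id] at this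
    rwa [← Matrix.toLin'_apply', LinearMap.toMatrix'_toLin'] at this
  have h2 := congrFun (congrFun h1 i) i'
  rw [Matrix.mul_apply, Matrix.one_apply] at h2
  exact h2

/-! ### Differential operators on vector-valued functions on the line -/

section PolyDiff

variable {F G : Type*} [NormedAddCommGroup F] [NormedSpace ℝ F] [NormedAddCommGroup G]
  [NormedSpace ℝ G]

/-- `p(∂) f` for a function `f` on `ℝ` with values in a normed space. -/
def polyDiff (p : ℝ[X]) (f : ℝ → F) (t : ℝ) : F :=
  p.sum fun k a => a • iteratedDeriv k f t

theorem diffOp_univ (p : ℝ[X]) (f : ℝ → ℝ) : diffOp univ p f = polyDiff p f := by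
  funext t
  simp only [diffOp, polyDiff, iteratedDerivWithin_univ, smul_eq_mul]

theorem polyDiff_eq_sum_range {p : ℝ[X]} {n : ℕ} (hp : p.natDegree ≤ n) (f : ℝ → F) (t : ℝ) :
    polyDiff p f t = ∑ k ∈ Finset.range (n + 1), p.coeff k • iteratedDeriv k f t :=
  sum_over_range' p (f := fun k a => a • iteratedDeriv k f t) (fun _ => zero_smul _ _) _
    (Nat.lt_succ_of_le hp)

theorem polyDiff_add (p q : ℝ[X]) (f : ℝ → F) :
    polyDiff (p + q) f = polyDiff p f + polyDiff q f := by
  funext t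
  exact sum_add_index p q _ (fun _ => zero_smul _ _) (fun _ _ _ => add_smul _ _ _)

theorem polyDiff_monomial (k : ℕ) (a : ℝ) (f : ℝ → F) :
    polyDiff (monomial k a) f = a • iteratedDeriv k f := by
  funext t
  exact sum_monomial_index a _ (zero_smul _ _)

theorem polyDiff_X_pow (k : ℕ) (f : ℝ → F) : polyDiff (X ^ k) f = iteratedDeriv k f := by
  rw [X_pow_eq_monomial, polyDiff_monomial, one_smul]

theorem iteratedDeriv_finsetSum {ι : Type*} (s : Finset ι) (f : ι → ℝ → F) {k : ℕ}
    (hf : ∀ i ∈ s, ContDiff ℝ k (f i)) (t : ℝ) :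
    iteratedDeriv k (fun x => ∑ i ∈ s, f i x) t = ∑ i ∈ s, iteratedDeriv k (f i) t := by
  classical
  induction s using Finset.induction_on with
  | empty => simp
  | insert i s hi ih =>
    simp only [Finset.sum_insert hi]
    have h1 : ContDiff ℝ k fun x => ∑ i ∈ s, f i x :=
      ContDiff.sum fun j hj => hf j (Finset.mem_insert_of_mem hj)
    rw [iteratedDeriv_fun_add (hf i (Finset.mem_insert_self _ _)).contDiffAt h1.contDiffAt,
      ih fun j hj => hf j (Finset.mem_insert_of_mem hj)]

theorem contDiff_iteratedDeriv {f : ℝ → F} {m k n : ℕ} (hf : ContDiff ℝ n f) (h : m + k ≤ n) :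
    ContDiff ℝ m (iteratedDeriv k f) := by
  induction k generalizing f n with
  | zero => simpa using hf.of_le (by exact_mod_cast h)
  | succ k ih =>
    rw [iteratedDeriv_succ']
    obtain ⟨n, rfl⟩ : ∃ n', n = n' + 1 := ⟨n - 1, by omega⟩
    refine ih (n := n) ?_ (by omega)
    exact (contDiff_succ_iff_deriv.mp (by exact_mod_cast hf)).2.2

theorem contDiff_polyDiff {p : ℝ[X]} {f : ℝ → F} {m n : ℕ} (hf : ContDiff ℝ n f)
    (h : m + p.natDegree ≤ n) : ContDiff ℝ m (polyDiff p f) := by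
  have : polyDiff p f =
      fun t => ∑ k ∈ Finset.range (p.natDegree + 1), p.coeff k • iteratedDeriv k f t :=
    funext fun t => polyDiff_eq_sum_range le_rfl f t
  rw [this]
  refine ContDiff.sum fun k hk => ContDiff.const_smul _ (contDiff_iteratedDeriv hf ?_)
  have := Finset.mem_range.mp hk
  omega

theorem contDiff_infty_polyDiff (p : ℝ[X]) {f : ℝ → F} (hf : ContDiff ℝ (⊤ : ℕ∞) f) :
    ContDiff ℝ (⊤ : ℕ∞) (polyDiff p f) := by
  refine contDiff_infty.mpr fun m => ?_
  exact contDiff_polyDiff (contDiff_infty.mp hf (m + p.natDegree)) le_rfl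

theorem iteratedDeriv_iteratedDeriv (j k : ℕ) (f : ℝ → F) :
    iteratedDeriv j (iteratedDeriv k f) = iteratedDeriv (j + k) f := by
  simp only [iteratedDeriv_eq_iterate, Function.iterate_add_apply]

theorem iteratedDeriv_polyDiff {p : ℝ[X]} {f : ℝ → F} {j n : ℕ} (hf : ContDiff ℝ n f)
    (h : j + p.natDegree ≤ n) (t : ℝ) :
    iteratedDeriv j (polyDiff p f) t =
      ∑ k ∈ Finset.range (p.natDegree + 1), p.coeff k • iteratedDeriv (j + k) f t := by
  have : polyDiff p f =
      fun t => ∑ k ∈ Finset.range (p.natDegree + 1), (p.coeff k • iteratedDeriv k f) t :=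
    funext fun t => polyDiff_eq_sum_range le_rfl f t
  have hk : ∀ k ∈ Finset.range (p.natDegree + 1), ContDiff ℝ j (iteratedDeriv k f) := fun k hk => by
    have := Finset.mem_range.mp hk
    exact contDiff_iteratedDeriv hf (by omega)
  rw [this, iteratedDeriv_finsetSum _ (fun k => p.coeff k • iteratedDeriv k f)
    fun k h => (hk k h).const_smul _]
  refine Finset.sum_congr rfl fun k h => ?_
  rw [iteratedDeriv_const_smul (hk k h).contDiffAt, iteratedDeriv_iteratedDeriv]

theorem iteratedDeriv_clm (L : F →L[ℝ] G) {f : ℝ → F} {k : ℕ} (hf : ContDiff ℝ k f) (t : ℝ) :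
    iteratedDeriv k (fun s => L (f s)) t = L (iteratedDeriv k f t) := by
  rw [iteratedDeriv_eq_iteratedFDeriv, iteratedDeriv_eq_iteratedFDeriv]
  have := L.iteratedFDeriv_comp_left hf.contDiffAt (x := t) (i := k) le_rfl
  rw [show (fun s => L (f s)) = L ∘ f from rfl, this]
  rfl

theorem polyDiff_clm (L : F →L[ℝ] G) {p : ℝ[X]} {f : ℝ → F} {n : ℕ} (hf : ContDiff ℝ n f)
    (h : p.natDegree ≤ n) (t : ℝ) : polyDiff p (fun s => L (f s)) t = L (polyDiff p f t) := by
  rw [polyDiff_eq_sum_range h, polyDiff_eq_sum_range h, map_sum]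
  refine Finset.sum_congr rfl fun k hk => ?_
  have := Finset.mem_range.mp hk
  rw [iteratedDeriv_clm L (hf.of_le (by exact_mod_cast (by omega : k ≤ n))), map_smul]

theorem iteratedDeriv_eqOn {f g : ℝ → F} {U : Set ℝ} (hU : IsOpen U) (h : EqOn f g U) (k : ℕ) :
    EqOn (iteratedDeriv k f) (iteratedDeriv k g) U := fun _ ht =>
  ((h.eventuallyEq_of_mem (hU.mem_nhds ht)).iteratedDeriv k).eq_of_nhds

theorem polyDiff_eqOn {f g : ℝ → F} {U : Set ℝ} (hU : IsOpen U) (h : EqOn f g U) (p : ℝ[X]) :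
    EqOn (polyDiff p f) (polyDiff p g) U := fun t ht => by
  simp only [polyDiff, iteratedDeriv_eqOn hU h _ ht]

end PolyDiff

/-- The smooth functions on the line, as a real vector space. -/
def smoothFn : Submodule ℝ (ℝ → ℝ) where
  carrier := {f | ContDiff ℝ (⊤ : ℕ∞) f}
  zero_mem' := by
    rw [mem_ofPred_eq]
    exact contDiff_const
  add_mem' := by
    intro f g hf hg
    rw [mem_ofPred_eq] at *
    exact hf.add hg
  smul_mem' := by
    intro c f hf
    rw [mem_ofPred_eq] at *
    exact contDiff_const.smul hf

theorem mem_smoothFn {f : ℝ → ℝ} : f ∈ smoothFn ↔ ContDiff ℝ (⊤ : ℕ∞) f := Iff.rfl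

theorem hasDerivAt_of_contDiff {f : ℝ → ℝ} {n : WithTop ℕ∞} (hf : ContDiff ℝ n f) (hn : n ≠ 0)
    (t : ℝ) : HasDerivAt f (deriv f t) t :=
  ((hf.differentiable hn) t).hasDerivAt

/-- Differentiation of smooth functions on the line. -/
def smoothDeriv : Module.End ℝ smoothFn where
  toFun f := ⟨deriv f.1, mem_smoothFn.mpr (contDiff_infty_iff_deriv.mp (mem_smoothFn.mp f.2)).2⟩
  map_add' f g := Subtype.ext <| funext fun t =>
    ((hasDerivAt_of_contDiff (mem_smoothFn.mp f.2) (by simp) t).add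
      (hasDerivAt_of_contDiff (mem_smoothFn.mp g.2) (by simp) t)).deriv
  map_smul' c f := Subtype.ext <| funext fun t =>
    ((hasDerivAt_of_contDiff (mem_smoothFn.mp f.2) (by simp) t).const_smul c).deriv

theorem aeval_smoothDeriv (p : ℝ[X]) (f : smoothFn) :
    (aeval smoothDeriv p f : ℝ → ℝ) = polyDiff p f.1 := by
  have hpow : ∀ k : ℕ, ((smoothDeriv ^ k) f : ℝ → ℝ) = iteratedDeriv k f.1 := by
    intro k
    induction k with
    | zero => simp
    | succ k ih =>
      rw [pow_succ', Module.End.mul_apply, iteratedDeriv_succ, ← ih]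
      rfl
  induction p using Polynomial.induction_on' with
  | add p q hp hq => simp [polyDiff_add, hp, hq]
  | monomial k a =>
    rw [polyDiff_monomial, aeval_monomial, Module.End.mul_apply, Module.algebraMap_end_apply,
      ← hpow]
    rfl

/-- The action of a polynomial matrix on smooth functions is the differential operator. -/
theorem polyAct_smoothDeriv {ι κ : Type*} [Fintype κ] (A : Matrix ι κ ℝ[X]) (x : κ → smoothFn)
    (i : ι) (t : ℝ) :
    (polyAct smoothDeriv A x i).1 t = ∑ j, polyDiff (A i j) (x j).1 t := by
  simp only [polyAct, ← aeval_smoothDeriv]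
  rw [AddSubmonoidClass.coe_finsetSum, Finset.sum_apply]

/-! ### Controllability and the diagonal entries of the Smith form -/

/-- Backward uniqueness for a scalar equation `p(∂) y = 0` with `p ≠ 0`. -/
theorem eq_zero_of_polyDiff_eq_zero {p : ℝ[X]} (hp : p ≠ 0) {y : ℝ → ℝ}
    (hy : ContDiff ℝ (⊤ : ℕ∞) y) (h : polyDiff p y = 0) {T : ℝ} (hT : ∀ t > T, y t = 0) :
    y = 0 := by
  set n := p.natDegree with hn
  have hlc : p.coeff n ≠ 0 := leadingCoeff_ne_zero.mpr hp
  have hyk : ∀ (k : ℕ) (t : ℝ), HasDerivAt (iteratedDeriv k y) (iteratedDeriv (k + 1) y t) t := by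
    intro k t
    rw [iteratedDeriv_succ]
    exact hasDerivAt_of_contDiff (n := 1)
      (contDiff_iteratedDeriv (m := 1) (n := 1 + k) (contDiff_infty.mp hy _) le_rfl) one_ne_zero t
  have heq : ∀ t, p.coeff n * iteratedDeriv n y t =
      -∑ k ∈ Finset.range n, p.coeff k * iteratedDeriv k y t := by
    intro t
    have := congrFun h t
    rw [polyDiff_eq_sum_range (le_refl p.natDegree), ← hn, Finset.sum_range_succ] at this
    simp only [smul_eq_mul, Pi.zero_apply] at this
    linarith
  -- the companion system for `(y, y', …, y⁽ⁿ⁻¹⁾)`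
  let v : (Fin n → ℝ) →ₗ[ℝ] (Fin n → ℝ) := LinearMap.pi fun k =>
    if hk : (k : ℕ) + 1 < n then LinearMap.proj ⟨k + 1, hk⟩
    else (-(p.coeff n)⁻¹) • ∑ i : Fin n, p.coeff i • LinearMap.proj i
  let x : ℝ → Fin n → ℝ := fun t k => iteratedDeriv k y t
  have hx : ∀ t, HasDerivAt x (v (x t)) t := by
    intro t
    rw [hasDerivAt_pi]
    intro k
    have hvk : v (x t) k = iteratedDeriv (k + 1) y t := by
      by_cases hk : (k : ℕ) + 1 < n
      · simp [v, hk, x]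
      · have hkn : (k : ℕ) + 1 = n := by omega
        simp only [v, hk, x, LinearMap.pi_apply, dite_false, LinearMap.smul_apply,
          LinearMap.sum_apply, LinearMap.proj_apply, smul_eq_mul]
        rw [hkn, Fin.sum_univ_eq_sum_range (fun k => p.coeff k * iteratedDeriv k y t) n]
        have := heq t
        field_simp
        linarith
    rw [hvk]
    exact hyk k t
  have hx0 : x (T + 1) = 0 := by
    funext k
    have : iteratedDeriv k y (T + 1) = iteratedDeriv k (fun _ => (0 : ℝ)) (T + 1) :=
      iteratedDeriv_eqOn isOpen_Ioi (fun t ht => hT t ht) k (mem_Ioi.mpr (lt_add_one T))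
    simpa [x] using this
  have hlip : LipschitzWith ‖LinearMap.toContinuousLinearMap v‖₊ v :=
    (LinearMap.toContinuousLinearMap v).lipschitz
  have hxz : x = fun _ => 0 :=
    ODE_solution_unique_univ (v := fun _ => v) (s := fun _ => univ) (t₀ := T + 1)
      (fun _ => hlip.lipschitzOnWith) (fun t => ⟨hx t, mem_univ _⟩)
      (fun t => ⟨by simpa using! hasDerivAt_const t (0 : Fin n → ℝ), mem_univ _⟩) hx0
  have hk0 : ∀ k < n, ∀ t, iteratedDeriv k y t = 0 := fun k hk t =>
    congrFun (congrFun hxz t) ⟨k, hk⟩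
  rcases Nat.eq_zero_or_pos n with h0 | h0
  · funext t
    have := heq t
    rw [h0] at this hlc
    simpa [hlc] using this
  · funext t
    simpa using hk0 0 h0 t

/-- A differential operator of positive order has a nontrivial kernel. -/
theorem exists_polyDiff_eq_zero {p : ℝ[X]} (hp : 0 < p.degree) :
    ∃ y : ℝ → ℝ, ContDiff ℝ (⊤ : ℕ∞) y ∧ polyDiff p y = 0 ∧ y 0 = 1 := by
  obtain ⟨z, hz⟩ := IsAlgClosed.exists_aeval_eq_zero ℂ p hp.ne'
  let e : ℝ → ℂ := fun t => Complex.exp (z * t)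
  have he : ContDiff ℝ (⊤ : ℕ∞) e :=
    (contDiff_const.mul Complex.ofRealCLM.contDiff).cexp
  have hd : ∀ t, HasDerivAt e (z * e t) t := by
    intro t
    have h1 : HasDerivAt (fun t : ℝ => z * (t : ℂ)) z t := by
      simpa using (Complex.ofRealCLM.hasDerivAt (x := t)).const_mul z
    simpa [e, mul_comm] using h1.cexp
  have hek : ∀ k, iteratedDeriv k e = fun t => z ^ k * e t := by
    intro k
    induction k with
    | zero => simp
    | succ k ih =>
      funext t
      rw [iteratedDeriv_succ, ih, ((hd t).const_mul (z ^ k)).deriv]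
      ring
  refine ⟨fun t => Complex.reCLM (e t), Complex.reCLM.contDiff.comp he, ?_, by simp [e]⟩
  funext t
  rw [polyDiff_clm Complex.reCLM (contDiff_infty.mp he p.natDegree) le_rfl,
    polyDiff_eq_sum_range le_rfl]
  have : ∑ k ∈ Finset.range (p.natDegree + 1), p.coeff k • iteratedDeriv k e t =
      aeval z p * e t := by
    rw [aeval_eq_sum_range, Finset.sum_mul]
    refine Finset.sum_congr rfl fun k _ => ?_
    rw [hek]
    simp [mul_assoc]
  rw [this, hz]
  simp

theorem polyAct_smoothDeriv_eqOn {ι κ : Type*} [Fintype κ] (A : Matrix ι κ ℝ[X])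
    {x x' : κ → smoothFn} {U : Set ℝ} (hU : IsOpen U) (h : ∀ j, EqOn (x j).1 (x' j).1 U) (i : ι) :
    EqOn (polyAct smoothDeriv A x i).1 (polyAct smoothDeriv A x' i).1 U := by
  intro t ht
  rw [polyAct_smoothDeriv, polyAct_smoothDeriv]
  exact Finset.sum_congr rfl fun j _ => polyDiff_eqOn hU (h j) _ ht

theorem isTrajectory_iff {n q : ℕ} (H : Matrix (Fin n) (Fin q) ℝ[X]) (x : Fin q → smoothFn) :
    IsTrajectory H (fun t j => (x j).1 t) ↔ polyAct smoothDeriv H x = 0 := by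
  constructor
  · rintro ⟨-, h⟩
    funext i
    refine Subtype.ext (funext fun t => ?_)
    rw [polyAct_smoothDeriv]
    simpa [diffOp_univ] using h i t
  · intro h
    refine ⟨contDiff_pi.mpr fun j => mem_smoothFn.mp (x j).2, fun i t => ?_⟩
    have := congrArg (fun f : Fin n → smoothFn => (f i).1 t) h
    simp only [polyAct_smoothDeriv] at this
    simpa [diffOp_univ] using this

/-- In the Smith form of a controllable system the nonzero diagonal entries are constants:
otherwise the nonzero solutions of `d(∂) y = 0` for such an entry `d` give trajectories that cannot
be steered to zero. -/
theorem isUnit_of_isControllable {n q : ℕ} {H : Matrix (Fin n) (Fin q) ℝ[X]}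
    (hH : IsControllable H) {Q : Matrix (Fin n) (Fin n) ℝ[X]} {V : Matrix (Fin q) (Fin q) ℝ[X]}
    {D : Matrix (Fin n) (Fin q) ℝ[X]} (hD : IsSmithForm H Q V D) {i : Fin n} {j : Fin q}
    (hij : D i j ≠ 0) : IsUnit (D i j) := by
  have hval : (i : ℕ) = j := by
    by_contra h
    exact hij (hD.diagonal i j h)
  by_contra hunit
  have hdeg : 0 < (D i j).degree := degree_pos_of_ne_zero_of_nonunit hij hunit
  obtain ⟨y, hy, hy0, hy1⟩ := exists_polyDiff_eq_zero hdeg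
  obtain ⟨V', hV⟩ := hD.isUnit_right
  obtain ⟨Q', hQ⟩ := hD.isUnit_left
  have hHV : H * V = (↑Q'⁻¹ : Matrix (Fin n) (Fin n) ℝ[X]) * D := by
    rw [← hD.eq, Matrix.mul_assoc Q, ← hQ, ← Matrix.mul_assoc, Units.inv_mul, Matrix.one_mul]
  have hDV : D * (↑V'⁻¹ : Matrix (Fin q) (Fin q) ℝ[X]) = Q * H := by
    rw [← hD.eq, Matrix.mul_assoc, ← hV, Units.mul_inv, Matrix.mul_one]
  let e : Fin q → smoothFn := Pi.single j ⟨y, mem_smoothFn.mpr hy⟩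
  have hDe : polyAct smoothDeriv D e = 0 := by
    funext i'
    simp only [polyAct]
    rw [Finset.sum_eq_single j]
    · by_cases hi : i' = i
      · subst hi
        refine Subtype.ext ?_
        rw [aeval_smoothDeriv]
        simpa [e] using hy0
      · rw [hD.diagonal i' j fun h => hi (Fin.ext (h.trans hval.symm))]
        simp
    · intro j' _ hj
      simp [e, hj]
    · simp
  let w₁ := polyAct smoothDeriv V e
  have hw₁ : IsTrajectory H fun t j => (w₁ j).1 t := by
    rw [isTrajectory_iff, ← polyAct_mul, hHV, polyAct_mul, hDe, polyAct_zero_right]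
  have hw₂ : IsTrajectory H fun t j => ((0 : Fin q → smoothFn) j).1 t := by
    rw [isTrajectory_iff, polyAct_zero_right]
  obtain ⟨T, -, w, hw, hpast, hfut⟩ := hH _ _ hw₁ hw₂
  let x : Fin q → smoothFn := fun j => ⟨fun t => w t j, mem_smoothFn.mpr (contDiff_pi.mp hw.1 j)⟩
  have hx : polyAct smoothDeriv H x = 0 := (isTrajectory_iff H x).mp hw
  -- in the coordinates given by `V`, component `j` of the steered trajectory solves `d(∂) Y = 0`,
  -- agrees with `y` on the past and vanishes eventually
  let Y := polyAct smoothDeriv (↑V'⁻¹ : Matrix (Fin q) (Fin q) ℝ[X]) x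
  have hY : polyDiff (D i j) (Y j).1 = 0 := by
    have h1 : polyAct smoothDeriv D Y i = 0 := by
      rw [← polyAct_mul, hDV, polyAct_mul, hx, polyAct_zero_right]
      rfl
    simp only [polyAct] at h1
    rw [Finset.sum_eq_single j] at h1
    · rw [← aeval_smoothDeriv, h1]
      rfl
    · intro j' _ hj
      rw [hD.diagonal i j' fun h => hj (Fin.ext (h.symm.trans hval))]
      simp
    · simp
  have hY0 : (Y j).1 = 0 := by
    refine eq_zero_of_polyDiff_eq_zero hij (mem_smoothFn.mp (Y j).2) hY (T := T) fun t ht => ?_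
    have h1 : EqOn (Y j).1
        (polyAct smoothDeriv (↑V'⁻¹ : Matrix (Fin q) (Fin q) ℝ[X]) 0 j).1 (Ioi T) := by
      refine polyAct_smoothDeriv_eqOn _ isOpen_Ioi (fun k s hs => ?_) j
      have := congrFun (hfut s (le_of_lt hs)) k
      simpa using this
    rw [h1 ht, polyAct_zero_right]
    rfl
  have hYy : EqOn (Y j).1 y (Iio 0) := by
    have h1 : EqOn (Y j).1
        (polyAct smoothDeriv (↑V'⁻¹ : Matrix (Fin q) (Fin q) ℝ[X]) w₁ j).1 (Iio 0) := by
      refine polyAct_smoothDeriv_eqOn _ isOpen_Iio (fun k s hs => ?_) j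
      exact congrFun (hpast s hs) k
    have h2 : polyAct smoothDeriv (↑V'⁻¹ : Matrix (Fin q) (Fin q) ℝ[X]) w₁ = e := by
      rw [← polyAct_mul, ← hV, Units.inv_mul, polyAct_one]
    rw [h2] at h1
    simpa [e] using h1
  have hlim : EqOn y 0 (closure (Iio 0)) := by
    refine EqOn.closure (fun t ht => ?_) hy.continuous continuous_const
    rw [← hYy ht, hY0]
  have := hlim (by simp : (0 : ℝ) ∈ closure (Iio 0))
  rw [hy1] at this
  exact one_ne_zero this

section Interval

/-! ### Distributions on an open interval -/

/-- Test functions on `(a, b)`: smooth functions vanishing outside a compact subinterval. -/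
def testFn (a b : ℝ) : Submodule ℝ (ℝ → ℝ) where
  carrier := {φ | ContDiff ℝ (⊤ : ℕ∞) φ ∧ ∃ c d, a < c ∧ d < b ∧ ∀ t ∉ Icc c d, φ t = 0}
  zero_mem' := by
    rw [mem_ofPred_eq]
    exact ⟨contDiff_const, a + 1, b - 1, by linarith, by linarith, fun _ _ => rfl⟩
  add_mem' := by
    rintro f g hf hg
    rw [mem_ofPred_eq] at *
    obtain ⟨hf, c, d, hc, hd, h⟩ := hf
    obtain ⟨hg, c', d', hc', hd', h'⟩ := hg
    refine ⟨hf.add hg, min c c', max d d', lt_min hc hc', max_lt hd hd', fun t ht => ?_⟩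
    rw [Pi.add_apply, h t, h' t, add_zero]
    · exact fun h => ht ⟨(min_le_right _ _).trans h.1, h.2.trans (le_max_right _ _)⟩
    · exact fun h => ht ⟨(min_le_left _ _).trans h.1, h.2.trans (le_max_left _ _)⟩
  smul_mem' := by
    rintro c f hf
    rw [mem_ofPred_eq] at *
    obtain ⟨hf, c', d, hc, hd, h⟩ := hf
    exact ⟨contDiff_const.smul hf, c', d, hc, hd, fun t ht => by simp [h t ht]⟩

variable {a b : ℝ}

theorem mem_testFn {φ : ℝ → ℝ} : φ ∈ testFn a b ↔
    ContDiff ℝ (⊤ : ℕ∞) φ ∧ ∃ c d, a < c ∧ d < b ∧ ∀ t ∉ Icc c d, φ t = 0 := Iff.rfl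

theorem testFn_contDiff (φ : testFn a b) : ContDiff ℝ (⊤ : ℕ∞) φ.1 := (mem_testFn.mp φ.2).1

theorem testFn_hasCompactSupport (φ : testFn a b) : HasCompactSupport φ.1 := by
  obtain ⟨-, c, d, -, -, h⟩ := mem_testFn.mp φ.2
  exact HasCompactSupport.intro isCompact_Icc fun t ht => h t ht

theorem testFn_tsupport (φ : testFn a b) : tsupport φ.1 ⊆ Ioo a b := by
  obtain ⟨-, c, d, hc, hd, h⟩ := mem_testFn.mp φ.2
  refine (closure_minimal (fun t ht => ?_) (isClosed_Icc (a := c) (b := d))).trans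
    fun t ht => ⟨hc.trans_le ht.1, ht.2.trans_lt hd⟩
  by_contra h'
  exact ht (h t h')

theorem mem_testFn_of_tsupport {φ : ℝ → ℝ} (hφ : ContDiff ℝ (⊤ : ℕ∞) φ)
    (hc : HasCompactSupport φ) (hs : tsupport φ ⊆ Ioo a b) : φ ∈ testFn a b := by
  refine mem_testFn.mpr ⟨hφ, ?_⟩
  rcases (tsupport φ).eq_empty_or_nonempty with h | h
  · refine ⟨a + 1, b - 1, by linarith, by linarith, fun t _ => ?_⟩
    rw [tsupport_eq_empty_iff.mp h]
    rfl
  · obtain ⟨c, hc1⟩ := hc.isCompact.exists_isLeast h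
    obtain ⟨d, hd1⟩ := hc.isCompact.exists_isGreatest h
    refine ⟨c, d, (hs hc1.1).1, (hs hd1.1).2, fun t ht => ?_⟩
    by_contra h0
    have : t ∈ tsupport φ := subset_tsupport _ h0
    exact ht ⟨hc1.2 this, hd1.2 this⟩

theorem deriv_mem_testFn (φ : testFn a b) : deriv φ.1 ∈ testFn a b := by
  refine mem_testFn_of_tsupport (contDiff_infty_iff_deriv.mp (testFn_contDiff φ)).2
    (testFn_hasCompactSupport φ).deriv ?_
  refine (closure_minimal support_deriv_subset (isClosed_tsupport _)).trans (testFn_tsupport φ)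

/-- Differentiation of test functions. -/
def testDeriv (a b : ℝ) : Module.End ℝ (testFn a b) where
  toFun φ := ⟨deriv φ.1, deriv_mem_testFn φ⟩
  map_add' f g := Subtype.ext <| funext fun t =>
    ((hasDerivAt_of_contDiff (testFn_contDiff f) (by simp) t).add
      (hasDerivAt_of_contDiff (testFn_contDiff g) (by simp) t)).deriv
  map_smul' c f := Subtype.ext <| funext fun t =>
    ((hasDerivAt_of_contDiff (testFn_contDiff f) (by simp) t).const_smul c).deriv

theorem aeval_testDeriv (p : ℝ[X]) (φ : testFn a b) :
    (aeval (testDeriv a b) p φ).1 = polyDiff p φ.1 := by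
  have hpow : ∀ k : ℕ, ((testDeriv a b ^ k) φ).1 = iteratedDeriv k φ.1 := by
    intro k
    induction k with
    | zero => simp
    | succ k ih =>
      rw [pow_succ', Module.End.mul_apply, iteratedDeriv_succ, ← ih]
      rfl
  induction p using Polynomial.induction_on' with
  | add p q hp hq => simp [polyDiff_add, hp, hq]
  | monomial k a =>
    rw [polyDiff_monomial, aeval_monomial, Module.End.mul_apply, Module.algebraMap_end_apply,
      ← hpow]
    rfl

/-- The space of all linear functionals on the test functions. No continuity is needed: every
functional that occurs is a derivative of a continuous function. -/
abbrev Distr (a b : ℝ) : Type := Module.Dual ℝ (testFn a b)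

/-- The distributional derivative. -/
def distrDeriv (a b : ℝ) : Module.End ℝ (Distr a b) := -(testDeriv a b).dualMap

theorem distrDeriv_apply (u : Distr a b) (φ : testFn a b) :
    distrDeriv a b u φ = -u (testDeriv a b φ) := rfl

theorem aeval_distrDeriv_apply (p : ℝ[X]) (u : Distr a b) (φ : testFn a b) :
    aeval (distrDeriv a b) p u φ = u (aeval (testDeriv a b) (p.comp (-X)) φ) := by
  have hpow : ∀ (k : ℕ) (φ : testFn a b),
      (distrDeriv a b ^ k) u φ = u (((-testDeriv a b) ^ k) φ) := by
    intro k
    induction k with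
    | zero => simp
    | succ k ih =>
      intro φ
      rw [pow_succ', Module.End.mul_apply, distrDeriv_apply, ih, pow_succ, Module.End.mul_apply,
        LinearMap.neg_apply, map_neg, map_neg]
  have hcomp : aeval (testDeriv a b) (p.comp (-X)) = aeval (-testDeriv a b) p := by
    rw [aeval_comp]
    simp
  rw [hcomp, aeval_eq_sum_range, aeval_eq_sum_range]
  simp [hpow]

theorem testFn_integrable (f : C(ℝ, ℝ)) (φ : testFn a b) : Integrable fun t => f t * φ.1 t :=
  (f.continuous.mul (testFn_contDiff φ).continuous).integrable_of_hasCompactSupport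
    (testFn_hasCompactSupport φ).mul_left

/-- The distribution given by a continuous function. -/
def ofFn (a b : ℝ) : C(ℝ, ℝ) →ₗ[ℝ] Distr a b where
  toFun f :=
    { toFun := fun φ => ∫ t, f t * φ.1 t
      map_add' := fun φ ψ => by
        rw [← integral_add (testFn_integrable f φ) (testFn_integrable f ψ)]
        exact integral_congr_ae (ae_of_all _ fun t => mul_add _ _ _)
      map_smul' := fun c φ => by
        rw [RingHom.id_apply, smul_eq_mul, ← integral_const_mul]
        exact integral_congr_ae (ae_of_all _ fun t => mul_left_comm _ _ _) }
  map_add' f g := LinearMap.ext fun φ => by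
    refine Eq.trans ?_ (integral_add (testFn_integrable f φ) (testFn_integrable g φ))
    exact integral_congr_ae (ae_of_all _ fun t => add_mul _ _ _)
  map_smul' c f := LinearMap.ext fun φ => by
    refine Eq.trans ?_ (integral_const_mul c _)
    exact integral_congr_ae (ae_of_all _ fun t => mul_assoc _ _ _)

theorem ofFn_apply (f : C(ℝ, ℝ)) (φ : testFn a b) : ofFn a b f φ = ∫ t, f t * φ.1 t := rfl

theorem distrDeriv_ofFn {f : ℝ → ℝ} (hf : ContDiff ℝ 1 f) :
    distrDeriv a b (ofFn a b ⟨f, hf.continuous⟩) =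
      ofFn a b ⟨deriv f, hf.continuous_deriv_one⟩ := by
  refine LinearMap.ext fun φ => ?_
  rw [distrDeriv_apply, ofFn_apply, ofFn_apply]
  have h := integral_mul_deriv_eq_deriv_mul_of_integrable (u := f) (u' := deriv f) (v := φ.1)
    (v' := deriv φ.1) (fun t _ => hasDerivAt_of_contDiff hf one_ne_zero t)
    (fun t _ => hasDerivAt_of_contDiff (testFn_contDiff φ) (by simp) t)
    (testFn_integrable ⟨f, hf.continuous⟩ (testDeriv a b φ))
    (testFn_integrable ⟨deriv f, hf.continuous_deriv_one⟩ φ)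
    (testFn_integrable ⟨f, hf.continuous⟩ φ)
  rw [neg_eq_iff_eq_neg]
  exact h

theorem distrDeriv_pow_ofFn {f : ℝ → ℝ} {k : ℕ} (hf : ContDiff ℝ k f) :
    (distrDeriv a b ^ k) (ofFn a b ⟨f, hf.continuous⟩) =
      ofFn a b ⟨iteratedDeriv k f, hf.continuous_iteratedDeriv' k⟩ := by
  induction k with
  | zero => simp
  | succ k ih =>
    have h1 : ContDiff ℝ k f := hf.of_le (by exact_mod_cast Nat.le_succ k)
    have h2 : ContDiff ℝ 1 (iteratedDeriv k f) := by
      have := contDiff_iteratedDeriv (m := 1) hf (k := k) (by omega)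
      exact_mod_cast this
    rw [pow_succ', Module.End.mul_apply, ih h1, distrDeriv_ofFn h2]
    simp only [iteratedDeriv_succ]

/-- Differential operators act on functions with sufficiently many derivatives as they do on the
corresponding distributions. -/
theorem aeval_distrDeriv_ofFn {p : ℝ[X]} {f : ℝ → ℝ} {n : ℕ} (hf : ContDiff ℝ n f)
    (hp : p.natDegree ≤ n) :
    aeval (distrDeriv a b) p (ofFn a b ⟨f, hf.continuous⟩) = ofFn a b ⟨polyDiff p f,
      (contDiff_polyDiff (m := 0) hf (by omega)).continuous⟩ := by
  have hk : ∀ k ≤ n, ContDiff ℝ k f := fun k hk => hf.of_le (by exact_mod_cast hk)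
  let g : ℕ → C(ℝ, ℝ) := fun k =>
    if h : k ≤ n then ⟨iteratedDeriv k f, (hk k h).continuous_iteratedDeriv' k⟩ else 0
  have hg : (⟨polyDiff p f, (contDiff_polyDiff (m := 0) hf (by omega)).continuous⟩ : C(ℝ, ℝ)) =
      ∑ k ∈ Finset.range (n + 1), p.coeff k • g k := by
    ext t
    rw [ContinuousMap.coe_mk, polyDiff_eq_sum_range hp, ContinuousMap.sum_apply]
    refine Finset.sum_congr rfl fun k hk' => ?_
    simp [g, Nat.le_of_lt_succ (Finset.mem_range.mp hk')]
  rw [hg, map_sum, aeval_eq_sum_range' (Nat.lt_succ_of_le hp), LinearMap.sum_apply]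
  refine Finset.sum_congr rfl fun k hk' => ?_
  have hk'' := Nat.le_of_lt_succ (Finset.mem_range.mp hk')
  rw [map_smul, LinearMap.smul_apply]
  simp [g, hk'', distrDeriv_pow_ofFn (hk k hk'')]

/-- A test function with integral zero is the derivative of a test function. -/
theorem exists_testDeriv_eq (φ : testFn a b) (h : ∫ t, φ.1 t = 0) :
    ∃ ψ, testDeriv a b ψ = φ := by
  obtain ⟨hφ, c, d, hc, hd, hz⟩ := mem_testFn.mp φ.2
  let ψ : ℝ → ℝ := fun t => ∫ s in a..t, φ.1 s
  have hder : ∀ t, HasDerivAt ψ (φ.1 t) t := fun t => hφ.continuous.integral_hasStrictDerivAt a t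
    |>.hasDerivAt
  have hderiv : deriv ψ = φ.1 := funext fun t => (hder t).deriv
  have hψ : ψ ∈ testFn a b := by
    refine mem_testFn.mpr ⟨contDiff_infty_iff_deriv.mpr ⟨fun t => (hder t).differentiableAt, by
      rwa [hderiv]⟩, c, d, hc, hd, fun t ht => ?_⟩
    rcases lt_or_ge t c with h1 | h1
    · refine (intervalIntegral.integral_congr (g := fun _ => (0 : ℝ)) fun s hs => ?_).trans
        (by simp)
      refine hz s fun h' => ?_
      rcases mem_uIcc.mp hs with h2 | h2 <;> linarith [h'.1, h2.2]
    · have h2 : d < t := by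
        by_contra h3
        exact ht ⟨h1, not_lt.mp h3⟩
      refine (intervalIntegral.integral_eq_integral_of_support_subset fun s hs => ?_).trans h
      by_contra h3
      refine hs (hz s fun h' => h3 ⟨hc.trans_le h'.1, h'.2.trans h2.le⟩)
  exact ⟨⟨ψ, hψ⟩, Subtype.ext hderiv⟩

theorem exists_testFn_integral_eq_one (hab : a < b) : ∃ φ : testFn a b, ∫ t, φ.1 t = 1 := by
  let f : ContDiffBump ((a + b) / 2) := ⟨(b - a) / 8, (b - a) / 4, by linarith, by linarith⟩
  refine ⟨⟨f.normed volume, mem_testFn.mpr ⟨f.contDiff_normed, (a + b) / 2 - (b - a) / 4,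
    (a + b) / 2 + (b - a) / 4, by linarith, by linarith, fun t ht => ?_⟩⟩, f.integral_normed⟩
  by_contra h0
  have h1 : t ∈ Function.support (f.normed volume) := h0
  rw [f.support_normed_eq, Real.ball_eq_Ioo] at h1
  exact ht (Ioo_subset_Icc_self h1)

/-- The du Bois-Reymond lemma: a distribution with derivative zero is a constant. -/
theorem exists_eq_const_of_distrDeriv_eq_zero (hab : a < b) {u : Distr a b}
    (hu : distrDeriv a b u = 0) : ∃ c : ℝ, u = ofFn a b (ContinuousMap.const ℝ c) := by
  obtain ⟨ρ, hρ⟩ := exists_testFn_integral_eq_one hab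
  refine ⟨u ρ, LinearMap.ext fun φ => ?_⟩
  have hint : ∀ ψ : testFn a b, Integrable ψ.1 := fun ψ => by
    simpa using testFn_integrable (ContinuousMap.const ℝ 1) ψ
  obtain ⟨ψ, hψ⟩ := exists_testDeriv_eq (φ - (∫ t, φ.1 t) • ρ) (by
    have : (fun t => (φ - (∫ t, φ.1 t) • ρ).1 t) = fun t => φ.1 t - (∫ t, φ.1 t) * ρ.1 t := rfl
    rw [this, integral_sub (hint φ) ((hint ρ).const_mul _), integral_const_mul, hρ]
    ring)
  have h1 : u (φ - (∫ t, φ.1 t) • ρ) = 0 := by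
    have := LinearMap.congr_fun hu ψ
    rw [distrDeriv_apply, hψ, LinearMap.zero_apply, neg_eq_zero] at this
    exact this
  rw [map_sub, map_smul, sub_eq_zero] at h1
  rw [h1, ofFn_apply]
  simp only [ContinuousMap.const_apply, smul_eq_mul]
  rw [integral_const_mul, mul_comm]

theorem eqOn_of_ofFn_eq {f g : C(ℝ, ℝ)} (h : ofFn a b f = ofFn a b g) : EqOn f g (Ioo a b) := by
  have hae : ∀ᵐ t, t ∈ Ioo a b → (f - g) t = 0 := by
    refine isOpen_Ioo.ae_eq_zero_of_integral_contDiff_smul_eq_zero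
      ((f - g).continuous.locallyIntegrable.locallyIntegrableOn _) fun φ h1 h2 h3 => ?_
    have h4 : ofFn a b (f - g) ⟨φ, mem_testFn_of_tsupport h1 h2 h3⟩ = 0 := by
      rw [map_sub, h, sub_self, LinearMap.zero_apply]
    rw [ofFn_apply] at h4
    simpa only [smul_eq_mul, mul_comm] using h4
  refine Measure.eqOn_open_of_ae_eq (μ := volume) ?_ isOpen_Ioo f.continuous.continuousOn
    g.continuous.continuousOn
  rw [EventuallyEq, ae_restrict_iff' measurableSet_Ioo]
  filter_upwards [hae] with t ht h5
  exact sub_eq_zero.mp (ht h5)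

/-! ### Orders of regularity and column-reduced parametrizations -/

/-- `u` has regularity `s` (an integer, possibly negative) if it is the `N`-th derivative of a
function of class `C^k` with `s + N ≤ k`. For `s ≥ 0` this says that `u` is of class `C^s`. -/
def HasReg (s : ℤ) (u : Distr a b) : Prop :=
  ∃ (N k : ℕ) (f : ℝ → ℝ) (hf : ContDiff ℝ k f), s + N ≤ k ∧
    u = (distrDeriv a b ^ N) (ofFn a b ⟨f, hf.continuous⟩)

/-- Every function of class `C^k` is the derivative of one of class `C^(k+1)`. -/
theorem exists_primitive {f : ℝ → ℝ} {k : ℕ} (hf : ContDiff ℝ k f) (c y : ℝ) :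
    ∃ g : ℝ → ℝ, ContDiff ℝ (k + 1 : ℕ) g ∧ deriv g = f ∧ g c = y := by
  have hder : ∀ t, HasDerivAt (fun t => y + ∫ s in c..t, f s) (f t) t := fun t =>
    ((hf.continuous.integral_hasStrictDerivAt c t).hasDerivAt).const_add y
  have hd : deriv (fun t => y + ∫ s in c..t, f s) = f := funext fun t => (hder t).deriv
  refine ⟨fun t => y + ∫ s in c..t, f s, ?_, hd, by simp⟩
  have : ContDiff ℝ ((k : WithTop ℕ∞) + 1) fun t => y + ∫ s in c..t, f s := by
    refine contDiff_succ_iff_deriv.mpr ⟨fun t => (hder t).differentiableAt, by simp, ?_⟩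
    rwa [hd]
  exact_mod_cast this

theorem hasReg_ofFn {f : ℝ → ℝ} {k : ℕ} (hf : ContDiff ℝ k f) :
    HasReg k (ofFn a b ⟨f, hf.continuous⟩) :=
  ⟨0, k, f, hf, by simp, by simp⟩

theorem HasReg.mono {s s' : ℤ} {u : Distr a b} (h : HasReg s u) (hs : s' ≤ s) : HasReg s' u := by
  obtain ⟨N, k, f, hf, h1, h2⟩ := h
  exact ⟨N, k, f, hf, by omega, h2⟩

/-- The number of derivatives in a representation may be increased. -/
theorem exists_eq_distrDeriv_pow_add {s : ℤ} {u : Distr a b} {N k : ℕ} {f : ℝ → ℝ}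
    (hf : ContDiff ℝ k f) (h : s + N ≤ k)
    (hu : u = (distrDeriv a b ^ N) (ofFn a b ⟨f, hf.continuous⟩)) (M : ℕ) :
    ∃ (k : ℕ) (f : ℝ → ℝ) (hf : ContDiff ℝ k f), s + (N + M : ℕ) ≤ k ∧
      u = (distrDeriv a b ^ (N + M)) (ofFn a b ⟨f, hf.continuous⟩) := by
  induction M with
  | zero => exact ⟨k, f, hf, h, hu⟩
  | succ M ih =>
    obtain ⟨k, f, hf, h1, h2⟩ := ih
    obtain ⟨g, hg, rfl, -⟩ := exists_primitive hf 0 0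
    refine ⟨k + 1, g, hg, by push_cast at h1 ⊢; omega, ?_⟩
    have hg1 : ContDiff ℝ 1 g := hg.of_le (by exact_mod_cast (by omega : 1 ≤ k + 1))
    rw [h2, ← add_assoc, pow_succ, Module.End.mul_apply, distrDeriv_ofFn hg1]

theorem HasReg.add {s : ℤ} {u v : Distr a b} (hu : HasReg s u) (hv : HasReg s v) :
    HasReg s (u + v) := by
  obtain ⟨N, k, f, hf, h1, h2⟩ := hu
  obtain ⟨N', k', f', hf', h1', h2'⟩ := hv
  obtain ⟨k, f, hf, h1, h2⟩ := exists_eq_distrDeriv_pow_add hf h1 h2 N'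
  obtain ⟨k', f', hf', h1', h2'⟩ := exists_eq_distrDeriv_pow_add hf' h1' h2' N
  rw [add_comm N' N] at h1' h2'
  have e1 : ContDiff ℝ (min k k' : ℕ) f := hf.of_le (by exact_mod_cast min_le_left _ _)
  have e2 : ContDiff ℝ (min k k' : ℕ) f' := hf'.of_le (by exact_mod_cast min_le_right _ _)
  refine ⟨N + N', min k k', fun t => f t + f' t, e1.add e2, by push_cast at *; omega, ?_⟩
  rw [h2, h2', ← map_add, ← map_add]
  rfl

theorem hasReg_zero (s : ℤ) : HasReg s (0 : Distr a b) := by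
  refine ⟨0, s.toNat, fun _ => 0, contDiff_const, by push_cast; omega, ?_⟩
  exact (map_zero (ofFn a b)).symm

theorem HasReg.smul {s : ℤ} {u : Distr a b} (hu : HasReg s u) (c : ℝ) : HasReg s (c • u) := by
  obtain ⟨N, k, f, hf, h1, h2⟩ := hu
  refine ⟨N, k, fun t => c * f t, contDiff_const.mul hf, h1, ?_⟩
  rw [h2, ← map_smul, ← map_smul]
  rfl

theorem HasReg.neg {s : ℤ} {u : Distr a b} (hu : HasReg s u) : HasReg s (-u) := by
  rw [← neg_one_smul ℝ u]
  exact hu.smul (-1)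

theorem HasReg.sum {ι : Type*} {S : Finset ι} {s : ℤ} {u : ι → Distr a b}
    (h : ∀ i ∈ S, HasReg s (u i)) : HasReg s (∑ i ∈ S, u i) := by
  classical
  induction S using Finset.induction_on with
  | empty => simpa using hasReg_zero s
  | insert i S hi ih =>
    rw [Finset.sum_insert hi]
    exact (h i (Finset.mem_insert_self _ _)).add
      (ih fun j hj => h j (Finset.mem_insert_of_mem hj))

theorem HasReg.distrDeriv_pow {s : ℤ} {u : Distr a b} (hu : HasReg s u) (n : ℕ) :
    HasReg (s - n) ((distrDeriv a b ^ n) u) := by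
  obtain ⟨N, k, f, hf, h1, h2⟩ := hu
  refine ⟨n + N, k, f, hf, by push_cast; omega, ?_⟩
  rw [h2, pow_add, Module.End.mul_apply]

theorem HasReg.aeval {s : ℤ} {u : Distr a b} (hu : HasReg s u) {p : ℝ[X]} {n : ℕ}
    (hp : p.natDegree ≤ n) : HasReg (s - n) (Polynomial.aeval (distrDeriv a b) p u) := by
  rw [aeval_eq_sum_range, LinearMap.sum_apply]
  refine HasReg.sum fun k hk => ?_
  have := Finset.mem_range.mp hk
  exact ((hu.distrDeriv_pow k).mono (by omega)).smul _

theorem HasReg.aeval_of_degree_lt {s : ℤ} {u : Distr a b} {p : ℝ[X]} {n : ℕ}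
    (hu : HasReg (s + n) u) (hp : p.degree < n) :
    HasReg (s + 1) (Polynomial.aeval (distrDeriv a b) p u) := by
  by_cases h0 : p = 0
  · simpa [h0] using hasReg_zero (s + 1)
  · have h1 := (natDegree_lt_iff_degree_lt h0).mpr hp
    exact (hu.aeval (n := n - 1) (by omega)).mono (by omega)

/-- Integration gains one order of regularity. -/
theorem HasReg.of_distrDeriv (hab : a < b) {s : ℤ} {u : Distr a b}
    (h : HasReg s (distrDeriv a b u)) : HasReg (s + 1) u := by
  obtain ⟨N, k, f, hf, h1, h2⟩ := h
  obtain ⟨k, f, hf, h1, h2⟩ := exists_eq_distrDeriv_pow_add hf h1 h2 1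
  rw [pow_succ', Module.End.mul_apply, ← sub_eq_zero, ← map_sub] at h2
  obtain ⟨c, hc⟩ := exists_eq_const_of_distrDeriv_eq_zero hab h2
  rw [sub_eq_iff_eq_add] at hc
  have e1 : HasReg (s + 1) ((distrDeriv a b ^ N) (ofFn a b ⟨f, hf.continuous⟩)) :=
    ⟨N, k, f, hf, by push_cast at h1; omega, rfl⟩
  have e2 : HasReg (s + 1) (ofFn a b (ContinuousMap.const ℝ c)) := by
    have := hasReg_ofFn (a := a) (b := b) (f := fun _ => c) (k := (s + 1).toNat) contDiff_const
    exact this.mono (by omega)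
  rw [hc]
  exact e2.add e1

theorem HasReg.of_distrDeriv_pow (hab : a < b) {s : ℤ} {u : Distr a b} {n : ℕ}
    (h : HasReg s ((distrDeriv a b ^ n) u)) : HasReg (s + n) u := by
  induction n generalizing u with
  | zero => simpa using h
  | succ n ih =>
    rw [pow_succ, Module.End.mul_apply] at h
    exact (ih h).of_distrDeriv hab |>.mono (by push_cast; omega)

theorem HasReg.exists_eq_ofFn {n : ℕ} {u : Distr a b} (h : HasReg n u) :
    ∃ (f : ℝ → ℝ) (hf : ContDiff ℝ n f), u = ofFn a b ⟨f, hf.continuous⟩ := by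
  obtain ⟨N, k, f, hf, h1, h2⟩ := h
  have h3 : ContDiff ℝ N f := hf.of_le (by exact_mod_cast (by omega : N ≤ k))
  exact ⟨iteratedDeriv N f, contDiff_iteratedDeriv hf (by omega), h2.trans (distrDeriv_pow_ofFn h3)⟩

/-- Regularity for a square system `A(∂) g = u` in which the diagonal entry of column `i` is monic
of degree `d i` and the other entries of the column have lower degree: if `u` is of class `C^m`,
then `g i` is of class `C^(m + d i)`. The lower order terms gain one derivative in each step. -/
theorem hasReg_of_polyAct_eq (hab : a < b) {ι : Type*} [Fintype ι] [DecidableEq ι]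
    {A : Matrix ι ι ℝ[X]} {d : ι → ℕ}
    (hA : ∀ i i', (A i i' - if i = i' then X ^ d i' else 0).degree < (d i' : WithBot ℕ))
    {g u : ι → Distr a b} (h : polyAct (distrDeriv a b) A g = u) {m s : ℤ}
    (hu : ∀ i, HasReg m (u i)) (hg : ∀ i, HasReg (s + d i) (g i)) (i : ι) :
    HasReg (m + d i) (g i) := by
  have step : ∀ s : ℤ, s + 1 ≤ m → (∀ i, HasReg (s + d i) (g i)) →
      ∀ i, HasReg (s + 1 + d i) (g i) := by
    intro s hs hg i
    refine HasReg.of_distrDeriv_pow hab ?_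
    have h1 : (distrDeriv a b ^ d i) (g i) = u i + -∑ i',
        aeval (distrDeriv a b) (A i i' - if i = i' then X ^ d i' else 0) (g i') := by
      rw [← h]
      simp only [polyAct, map_sub, LinearMap.sub_apply, Finset.sum_sub_distrib, neg_sub,
        add_sub_cancel]
      rw [Finset.sum_eq_single i]
      · simp
      · intro j _ hj
        simp [hj.symm]
      · simp
    rw [h1]
    exact ((hu i).mono hs).add
      (HasReg.sum fun i' _ => (hg i').aeval_of_degree_lt (hA i i')).neg
  have key : ∀ n : ℕ, ∀ i, HasReg (min (s + n) m + d i) (g i) := by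
    intro n
    induction n with
    | zero => exact fun i => (hg i).mono (by push_cast; omega)
    | succ n ih =>
      intro i
      rcases lt_or_ge (s + n) m with h1 | h1
      · exact (step _ (by omega) ih i).mono (by push_cast; omega)
      · exact (ih i).mono (by push_cast; omega)
  exact (key (m - s).toNat i).mono (by omega)

/-- If `z` is of class `C^m` and `z = P(∂) g` in the sense of distributions on `(a, b)`, then in a
column-reduced parametrization `P * W` with column degrees `d i` one has `z = (P * W)(∂) f` with
functions `f i` of class `C^(m + d i)`. -/
theorem exists_regular_preimage (hab : a < b) {q : ℕ} {ι : Type} [Fintype ι] [DecidableEq ι]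
    {P : Matrix (Fin q) ι ℝ[X]} {U : Matrix ι (Fin q) ℝ[X]} (hU : U * P = 1)
    {W W' : Matrix ι ι ℝ[X]} (hW : W * W' = 1) {d : ι → ℕ} {L : Matrix ι (Fin q) ℝ}
    (hd : ∀ j i, ((P * W) j i).natDegree ≤ d i)
    (hL : ∀ i i', ∑ j, L i j * ((P * W) j i').coeff (d i') = if i = i' then 1 else 0)
    {m : ℕ} {z : Fin q → ℝ → ℝ} (hz : ∀ j, ContDiff ℝ m (z j)) {g : ι → Distr a b}
    (hg : polyAct (distrDeriv a b) P g = fun j => ofFn a b ⟨z j, (hz j).continuous⟩) :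
    ∃ f : ι → ℝ → ℝ, (∀ i, ContDiff ℝ (m + d i : ℕ) (f i)) ∧
      ∀ j, EqOn (z j) (fun t => ∑ i, polyDiff ((P * W) j i) (f i) t) (Ioo a b) := by
  let Z : Fin q → Distr a b := fun j => ofFn a b ⟨z j, (hz j).continuous⟩
  have hZ : ∀ j, HasReg m (Z j) := fun j => hasReg_ofFn (hz j)
  let g' := polyAct (distrDeriv a b) W' g
  have hPg' : polyAct (distrDeriv a b) (P * W) g' = Z := by
    rw [← polyAct_mul, Matrix.mul_assoc, hW, Matrix.mul_one, hg]
  have hg'Z : g' = polyAct (distrDeriv a b) (W' * U) Z := by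
    have : g = polyAct (distrDeriv a b) U Z := by
      rw [show Z = _ from hg.symm, ← polyAct_mul, hU, polyAct_one]
    rw [polyAct_mul, ← this]
  -- combining the equations by `L` gives a square system with monic diagonal
  let A : Matrix ι ι ℝ[X] := L.map C * (P * W)
  have hAcoeff : ∀ i i' n, (A i i').coeff n = ∑ j, L i j * ((P * W) j i').coeff n := by
    intro i i' n
    simp only [A, Matrix.mul_apply (M := L.map C), Matrix.map_apply, finsetSum_coeff, coeff_C_mul]
  have hA : ∀ i i', (A i i' - if i = i' then X ^ d i' else 0).degree < (d i' : WithBot ℕ) := by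
    intro i i'
    rw [degree_lt_iff_coeff_zero]
    intro n hn
    rw [coeff_sub, hAcoeff]
    rcases eq_or_lt_of_le hn with h | h
    · rw [← h, hL]
      split_ifs <;> simp
    · have h1 : ∀ j, ((P * W) j i').coeff n = 0 := fun j =>
        coeff_eq_zero_of_natDegree_lt ((hd j i').trans_lt h)
      split_ifs <;> simp [h1, coeff_X_pow, h.ne']
  have hAg : polyAct (distrDeriv a b) A g' = polyAct (distrDeriv a b) (L.map C) Z := by
    rw [polyAct_mul, hPg']
  have hu : ∀ i, HasReg m (polyAct (distrDeriv a b) (L.map C) Z i) := fun i =>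
    HasReg.sum fun j _ => by simpa using (hZ j).aeval (p := C (L i j)) (n := 0) (by simp)
  -- some initial regularity of `g'`, possibly negative: it is obtained from `z` by differentiation
  let B := W' * U
  let M : ℕ := Finset.univ.sup fun i => Finset.univ.sup fun j => (B i j).natDegree
  have hB : ∀ i j, (B i j).natDegree ≤ M := fun i j =>
    (Finset.le_sup (f := fun j => (B i j).natDegree) (Finset.mem_univ j)).trans
      (Finset.le_sup (f := fun i => Finset.univ.sup fun j => (B i j).natDegree) (Finset.mem_univ i))
  have hg' : ∀ i, HasReg ((m : ℤ) - M - (∑ i, d i : ℕ) + d i) (g' i) := by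
    intro i
    have h1 : HasReg ((m : ℤ) - M) (g' i) := by
      rw [hg'Z]
      exact HasReg.sum fun j _ => (hZ j).aeval (hB i j)
    have h2 : d i ≤ ∑ i, d i := Finset.single_le_sum (fun _ _ => Nat.zero_le _) (Finset.mem_univ i)
    exact h1.mono (by omega)
  have hreg := hasReg_of_polyAct_eq hab hA hAg hu hg'
  choose f hf hgf using fun i => HasReg.exists_eq_ofFn (n := m + d i) (by simpa using hreg i)
  refine ⟨f, hf, fun j => ?_⟩
  have hcont : ∀ i, Continuous (polyDiff ((P * W) j i) (f i)) := fun i =>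
    (contDiff_polyDiff (m := 0) (hf i) (by have := hd j i; omega)).continuous
  have h1 : ofFn a b ⟨z j, (hz j).continuous⟩ =
      ofFn a b ⟨fun t => ∑ i, polyDiff ((P * W) j i) (f i) t,
        continuous_finsetSum _ fun i _ => hcont i⟩ := by
    have h2 := congrFun hPg' j
    simp only [polyAct] at h2
    have h3 : (⟨fun t => ∑ i, polyDiff ((P * W) j i) (f i) t,
        continuous_finsetSum _ fun i _ => hcont i⟩ : C(ℝ, ℝ)) =
        ∑ i, ⟨polyDiff ((P * W) j i) (f i), hcont i⟩ := by
      ext t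
      simp [ContinuousMap.sum_apply]
    rw [h3, map_sum]
    refine h2.symm.trans (Finset.sum_congr rfl fun i _ => ?_)
    rw [hgf i, aeval_distrDeriv_ofFn (hf i) (by have := hd j i; omega)]
  exact eqOn_of_ofFn_eq h1

/-! ### Approximation of solutions by images of test functions -/

/-- A function of class `C^m` on a compact interval extends to the line. -/
theorem exists_contDiff_extension (hab : a < b) {m : ℕ} {z : ℝ → ℝ}
    (hz : ContDiffOn ℝ m z (Icc a b)) :
    ∃ w : ℝ → ℝ, ContDiff ℝ m w ∧ EqOn w z (Icc a b) := by
  induction m generalizing z with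
  | zero =>
    refine ⟨IccExtend hab.le ((Icc a b).domRestrict z), ?_, fun t ht => ?_⟩
    · have := (continuousOn_iff_continuous_domRestrict.mp hz.continuousOn).Icc_extend' (h := hab.le)
      exact_mod_cast contDiff_zero.mpr this
    · rw [IccExtend_of_mem _ _ ht]
      rfl
  | succ m ih =>
    have hu : UniqueDiffOn ℝ (Icc a b) := uniqueDiffOn_Icc hab
    obtain ⟨h1, -, h2⟩ := (contDiffOn_succ_iff_derivWithin hu).mp
      (by exact_mod_cast hz : ContDiffOn ℝ (m + 1) z (Icc a b))
    obtain ⟨w, hw, hwz⟩ := ih h2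
    obtain ⟨g, hg, rfl, hga⟩ := exists_primitive hw a (z a)
    refine ⟨g, hg, fun t ht => ?_⟩
    have hgd : Differentiable ℝ g := hg.differentiable (by simp)
    have h3 := constant_of_derivWithin_zero (f := g - z) (hgd.differentiableOn.sub h1)
      (fun x hx => ?_) t ht
    · simpa [hga, sub_eq_zero] using h3
    · have hx' := Ico_subset_Icc_self hx
      rw [derivWithin_sub hgd.differentiableAt.differentiableWithinAt (h1 x hx'),
        hgd.differentiableAt.derivWithin (hu x hx'), hwz hx', sub_self]

theorem exists_smooth_approx_Icc (hab : a < b) {n : ℕ} {f : ℝ → ℝ} (hf : ContDiff ℝ n f) {ε : ℝ}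
    (hε : 0 < ε) : ∃ g : ℝ → ℝ, ContDiff ℝ (⊤ : ℕ∞) g ∧ ∀ k ≤ n, ∀ t ∈ Icc a b,
      |iteratedDeriv k g t - iteratedDeriv k f t| ≤ ε := by
  induction n generalizing f ε with
  | zero =>
    obtain ⟨p, hp⟩ := exists_polynomial_near_of_continuousOn a b f hf.continuous.continuousOn ε hε
    refine ⟨fun t => p.eval t, by simpa using p.contDiff_aeval (𝕜 := ℝ) (⊤ : ℕ∞),
      fun k hk t ht => ?_⟩
    obtain rfl := Nat.le_zero.mp hk
    simpa using (hp t ht).le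
  | succ n ih =>
    obtain ⟨hfd, -, hf'⟩ := contDiff_succ_iff_deriv.mp (by exact_mod_cast hf : ContDiff ℝ (n + 1) f)
    have hl : 0 < b - a := sub_pos.mpr hab
    obtain ⟨g', hg', happ⟩ := ih hf' (lt_min hε (div_pos hε hl))
    have hder : ∀ t, HasDerivAt (fun t => f a + ∫ s in a..t, g' s) (g' t) t := fun t =>
      ((hg'.continuous.integral_hasStrictDerivAt a t).hasDerivAt).const_add (f a)
    set g : ℝ → ℝ := fun t => f a + ∫ s in a..t, g' s with hg
    have hd : deriv g = g' := funext fun t => (hder t).deriv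
    refine ⟨g, contDiff_infty_iff_deriv.mpr ⟨fun t => (hder t).differentiableAt, by rwa [hd]⟩,
      fun k hk t ht => ?_⟩
    rcases Nat.eq_zero_or_pos k with rfl | hk0
    · have h1 := norm_image_sub_le_of_norm_deriv_le_segment' (f := fun t => g t - f t)
        (f' := fun t => g' t - deriv f t) (C := ε / (b - a)) (a := a) (b := b)
        (fun x _ => ((hder x).sub (hfd x).hasDerivAt).hasDerivWithinAt)
        (fun x hx => by
          have := happ 0 (Nat.zero_le _) x (Ico_subset_Icc_self hx)
          simpa using this.trans (min_le_right _ _)) t ht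
      have h2 : g a - f a = 0 := by simp [hg]
      rw [h2, sub_zero, Real.norm_eq_abs] at h1
      simp only [iteratedDeriv_zero]
      refine h1.trans ?_
      rw [div_mul_eq_mul_div, div_le_iff₀ hl]
      exact mul_le_mul_of_nonneg_left (by linarith [ht.2]) hε.le
    · obtain ⟨k, rfl⟩ : ∃ j, k = j + 1 := ⟨k - 1, by omega⟩
      rw [iteratedDeriv_succ', iteratedDeriv_succ', hd]
      exact (happ k (by omega) t ht).trans (min_le_left _ _)

/-- Smooth functions with compact support are dense in `C^n` on compact intervals. -/
theorem exists_compactSupport_approx_Icc (hab : a < b) {n : ℕ} {f : ℝ → ℝ} (hf : ContDiff ℝ n f)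
    {ε : ℝ} (hε : 0 < ε) : ∃ g : ℝ → ℝ, ContDiff ℝ (⊤ : ℕ∞) g ∧ HasCompactSupport g ∧
      ∀ k ≤ n, ∀ t ∈ Icc a b, |iteratedDeriv k g t - iteratedDeriv k f t| ≤ ε := by
  obtain ⟨g, hg, happ⟩ := exists_smooth_approx_Icc hab hf hε
  let ψ : ContDiffBump ((a + b) / 2) := ⟨b - a, 2 * (b - a), by linarith, by linarith⟩
  refine ⟨fun t => g t * ψ t, hg.mul ψ.contDiff, ψ.hasCompactSupport.mul_left, fun k hk t ht => ?_⟩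
  have heq : EqOn (fun t => g t * ψ t) g (Metric.ball ((a + b) / 2) (b - a)) := fun s hs => by
    simp only [ψ.one_of_mem_closedBall (Metric.ball_subset_closedBall hs), mul_one]
  have htb : t ∈ Metric.ball ((a + b) / 2) (b - a) := by
    rw [Real.ball_eq_Ioo]
    exact ⟨by linarith [ht.1], by linarith [ht.2]⟩
  rw [iteratedDeriv_eqOn Metric.isOpen_ball heq k htb]
  exact happ k hk t ht

theorem hasCompactSupport_polyDiff (p : ℝ[X]) {f : ℝ → ℝ} (hf : HasCompactSupport f) :
    HasCompactSupport (polyDiff p f) := by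
  refine HasCompactSupport.intro hf.isCompact fun t ht => ?_
  have h1 : EqOn f (fun _ => 0) (tsupport f)ᶜ := fun s hs => image_eq_zero_of_notMem_tsupport hs
  rw [polyDiff_eqOn (isClosed_tsupport f).isOpen_compl h1 p ht]
  simp [polyDiff, Polynomial.sum]

/-- A distributional solution `z = P(∂) g` of class `C^m` on `(a, b)`, where `P` has a left inverse,
can be approximated in `C^m([a, b])` by functions `P(∂) γ` with `γ` smooth of compact support. -/
theorem exists_polyDiff_approx (hab : a < b) {q : ℕ} {ι : Type} [Fintype ι] [DecidableEq ι]
    {P : Matrix (Fin q) ι ℝ[X]} {U : Matrix ι (Fin q) ℝ[X]} (hU : U * P = 1)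
    {m : ℕ} {z : Fin q → ℝ → ℝ} (hz : ∀ j, ContDiff ℝ m (z j)) {g : ι → Distr a b}
    (hg : polyAct (distrDeriv a b) P g = fun j => ofFn a b ⟨z j, (hz j).continuous⟩)
    {ε : ℝ} (hε : 0 < ε) :
    ∃ γ : ι → ℝ → ℝ, (∀ i, ContDiff ℝ (⊤ : ℕ∞) (γ i)) ∧ (∀ i, HasCompactSupport (γ i)) ∧
      ∀ j, ∀ k ≤ m, ∀ t ∈ Icc a b,
        |iteratedDeriv k (fun t => ∑ i, polyDiff (P j i) (γ i) t) t
          - iteratedDeriv k (z j) t| ≤ ε := by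
  obtain ⟨W, d, L, hW, hd, hL⟩ := exists_column_reduced P U hU
  obtain ⟨W', hW'⟩ : ∃ W', W * W' = 1 := by
    obtain ⟨u, rfl⟩ := hW
    exact ⟨_, u.mul_inv⟩
  obtain ⟨f, hf, hfz⟩ := exists_regular_preimage hab hU hW' hd hL hz hg
  let R := P * W
  let c : Fin q → ι → ℝ := fun j i => ∑ l ∈ Finset.range ((R j i).natDegree + 1), |(R j i).coeff l|
  have hc : ∀ j i, 0 ≤ c j i := fun j i => Finset.sum_nonneg fun l _ => abs_nonneg _
  let K : ℝ := ∑ j, ∑ i, c j i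
  have hK : 0 ≤ K := Finset.sum_nonneg fun j _ => Finset.sum_nonneg fun i _ => hc j i
  have hδ : 0 < ε / (K + 1) := by positivity
  choose χ hχ hχc hχa using fun i => exists_compactSupport_approx_Icc hab (hf i) hδ
  let x : ι → smoothFn := fun i => ⟨χ i, mem_smoothFn.mpr (hχ i)⟩
  have hPW : ∀ j t, ∑ i, polyDiff (P j i) (polyAct smoothDeriv W x i).1 t =
      ∑ i, polyDiff (R j i) (χ i) t := fun j t => by
    rw [← polyAct_smoothDeriv P, ← polyAct_mul, polyAct_smoothDeriv]
  refine ⟨fun i => (polyAct smoothDeriv W x i).1, fun i => mem_smoothFn.mp (Subtype.property _),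
    fun i => ?_, fun j k hk t ht => ?_⟩
  · have : (polyAct smoothDeriv W x i).1 = fun t => ∑ l, polyDiff (W i l) (χ l) t :=
      funext fun t => polyAct_smoothDeriv W x i t
    beta_reduce
    rw [this]
    refine HasCompactSupport.intro
      (isCompact_iUnion fun l => (hasCompactSupport_polyDiff (W i l) (hχc l)).isCompact)
      fun t ht => Finset.sum_eq_zero fun l _ => ?_
    exact image_eq_zero_of_notMem_tsupport fun h => ht (mem_iUnion.mpr ⟨l, h⟩)
  · simp only [hPW]
    have hdeg : ∀ i, k + (R j i).natDegree ≤ m + d i := fun i => by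
      have := hd j i
      simp only [R]
      omega
    have hRf : ∀ i, ContDiff ℝ k (polyDiff (R j i) (f i)) := fun i =>
      contDiff_polyDiff (hf i) (hdeg i)
    have hRχ : ∀ i, ContDiff ℝ k (polyDiff (R j i) (χ i)) := fun i =>
      (contDiff_infty.mp (contDiff_infty_polyDiff _ (hχ i)) k)
    -- the derivatives of `z` and of its representation agree up to the boundary
    have hzf : iteratedDeriv k (z j) t = ∑ i, iteratedDeriv k (polyDiff (R j i) (f i)) t := by
      rw [← iteratedDeriv_finsetSum _ _ fun i _ => hRf i]
      have h1 : EqOn (iteratedDeriv k (z j))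
          (iteratedDeriv k fun t => ∑ i, polyDiff (R j i) (f i) t) (closure (Ioo a b)) :=
        (iteratedDeriv_eqOn isOpen_Ioo (hfz j) k).closure
          ((hz j).continuous_iteratedDeriv k (by exact_mod_cast hk))
          ((ContDiff.sum fun i _ => hRf i).continuous_iteratedDeriv' k)
      rw [closure_Ioo hab.ne] at h1
      exact h1 ht
    rw [hzf, iteratedDeriv_finsetSum _ _ fun i _ => hRχ i, ← Finset.sum_sub_distrib]
    refine (Finset.abs_sum_le_sum_abs _ _).trans ?_
    have hterm : ∀ i, |iteratedDeriv k (polyDiff (R j i) (χ i)) t -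
        iteratedDeriv k (polyDiff (R j i) (f i)) t| ≤ c j i * (ε / (K + 1)) := by
      intro i
      rw [iteratedDeriv_polyDiff (hf i) (hdeg i),
        iteratedDeriv_polyDiff (contDiff_infty.mp (hχ i) (m + d i)) (hdeg i),
        ← Finset.sum_sub_distrib, Finset.sum_mul]
      refine (Finset.abs_sum_le_sum_abs _ _).trans (Finset.sum_le_sum fun l hl => ?_)
      rw [← smul_sub, smul_eq_mul, abs_mul]
      refine mul_le_mul_of_nonneg_left (hχa i _ ?_ t ht) (abs_nonneg _)
      have := Finset.mem_range.mp hl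
      have := hdeg i
      omega
    refine (Finset.sum_le_sum fun i _ => hterm i).trans ?_
    rw [← Finset.sum_mul]
    have hcK : ∑ i, c j i ≤ K := Finset.single_le_sum (f := fun j => ∑ i, c j i)
      (fun j _ => Finset.sum_nonneg fun i _ => hc j i) (Finset.mem_univ j)
    calc (∑ i, c j i) * (ε / (K + 1)) ≤ (K + 1) * (ε / (K + 1)) :=
          mul_le_mul_of_nonneg_right (by linarith) hδ.le
      _ = ε := by field_simp

/-! ### The parametrization of the solution set -/

theorem ext_apply {S : Set ℝ} (f : S → ℝ) {t : ℝ} (ht : t ∈ S) : ext f t = f ⟨t, ht⟩ :=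
  Subtype.val_injective.extend_apply f 0 ⟨t, ht⟩

section Smith

variable {n q : ℕ} {H : Matrix (Fin n) (Fin q) ℝ[X]} {Q : Matrix (Fin n) (Fin n) ℝ[X]}
  {V : Matrix (Fin q) (Fin q) ℝ[X]} {D : Matrix (Fin n) (Fin q) ℝ[X]}

theorem mul_parametrization (hD : IsSmithForm H Q V D) : H * parametrization V D = 0 := by
  obtain ⟨u, hu⟩ := hD.isUnit_left
  have hHV : H * V = (↑u⁻¹ : Matrix (Fin n) (Fin n) ℝ[X]) * D := by
    rw [← hD.eq, Matrix.mul_assoc Q, ← hu, ← Matrix.mul_assoc, Units.inv_mul, Matrix.one_mul]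
  ext1 i j
  have h1 : (H * parametrization V D) i j = (H * V) i j.1 := rfl
  rw [h1, hHV, Matrix.mul_apply]
  exact Finset.sum_eq_zero fun k _ => by rw [j.2 k, mul_zero]

theorem exists_leftInverse_parametrization [DecidableEq (ZeroCol D)] (hD : IsSmithForm H Q V D) :
    ∃ U : Matrix (ZeroCol D) (Fin q) ℝ[X], U * parametrization V D = 1 := by
  obtain ⟨u, hu⟩ := hD.isUnit_right
  refine ⟨fun i j => (↑u⁻¹ : Matrix (Fin q) (Fin q) ℝ[X]) i.1 j, ?_⟩
  ext1 i j
  have h1 : ((↑u⁻¹ : Matrix (Fin q) (Fin q) ℝ[X]) * V) i.1 j.1 =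
      (1 : Matrix (ZeroCol D) (ZeroCol D) ℝ[X]) i j := by
    rw [← hu, Units.inv_mul, Matrix.one_apply, Matrix.one_apply]
    exact if_congr Subtype.ext_iff.symm rfl rfl
  exact h1

/-- For a controllable system every solution, in any space on which the differential operators
act, is in the image of the parametrization. -/
theorem exists_eq_polyAct_parametrization {M : Type*} [AddCommGroup M] [Module ℝ M]
    (hH : IsControllable H) (hD : IsSmithForm H Q V D) (E : Module.End ℝ M) {z : Fin q → M}
    (hz : polyAct E H z = 0) : ∃ y : ZeroCol D → M, polyAct E (parametrization V D) y = z := by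
  obtain ⟨u, hu⟩ := hD.isUnit_right
  have hDV : D * (↑u⁻¹ : Matrix (Fin q) (Fin q) ℝ[X]) = Q * H := by
    rw [← hD.eq, Matrix.mul_assoc, ← hu, Units.mul_inv, Matrix.mul_one]
  let y := polyAct E (↑u⁻¹ : Matrix (Fin q) (Fin q) ℝ[X]) z
  have hDy : polyAct E D y = 0 := by
    rw [← polyAct_mul, hDV, polyAct_mul, hz, polyAct_zero_right]
  have hVy : polyAct E V y = z := by
    rw [← polyAct_mul, ← hu, Units.mul_inv, polyAct_one]
  have hy0 : ∀ j, (¬∀ i, D i j = 0) → y j = 0 := by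
    intro j hj
    push Not at hj
    obtain ⟨i, hij⟩ := hj
    have hval : (i : ℕ) = j := by
      by_contra h
      exact hij (hD.diagonal i j h)
    have h1 := congrFun hDy i
    simp only [polyAct] at h1
    rw [Finset.sum_eq_single j] at h1
    · obtain ⟨v, hv⟩ := isUnit_of_isControllable hH hD hij
      have h2 : aeval E ((↑v⁻¹ : ℝ[X]) * D i j) (y j) = 0 := by
        rw [map_mul, Module.End.mul_apply, h1, Pi.zero_apply, map_zero]
      rwa [← hv, Units.inv_mul, map_one, Module.End.one_apply] at h2
    · intro j' _ hj'
      rw [hD.diagonal i j' fun h => hj' (Fin.ext (h.symm.trans hval))]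
      simp
    · simp
  refine ⟨fun j => y j.1, ?_⟩
  rw [← hVy]
  funext i
  refine Fintype.sum_of_injective (ι := ZeroCol D) (fun j => j.1) Subtype.val_injective
    (fun j => aeval E (V i j.1) (y j.1)) (fun j => aeval E (V i j) (y j)) ?_ fun _ => rfl
  intro j hj
  rw [hy0 j fun h => hj ⟨⟨j, h⟩, rfl⟩, map_zero]

end Smith

/-- On a compact subinterval, a solution of class `C^m` on `S` gives a distributional solution. -/
theorem polyAct_eq_zero_of_mem_sol {n q m : ℕ} {H : Matrix (Fin n) (Fin q) ℝ[X]} {S : Set ℝ}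
    {z : CmSpace S m q} (hz : z ∈ sol S m H) (hS : Icc a b ⊆ S) {w : Fin q → C(ℝ, ℝ)}
    (hw : ∀ j, EqOn (w j) (ext fun t => z.1 t j) (Icc a b)) :
    polyAct (distrDeriv a b) H (fun j => ofFn a b (w j)) = 0 := by
  funext i
  refine LinearMap.ext fun φ => ?_
  have hint : Ioo a b ⊆ interior S := interior_maximal (Ioo_subset_Icc_self.trans hS) isOpen_Ioo
  have h1 := hz φ.1 (testFn_contDiff φ) (testFn_hasCompactSupport φ)
    ((testFn_tsupport φ).trans hint) i
  simp only [polyAct, LinearMap.sum_apply, Pi.zero_apply, LinearMap.zero_apply]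
  rw [← h1]
  refine Finset.sum_congr rfl fun j _ => ?_
  rw [aeval_distrDeriv_apply, ofFn_apply, diffOp_univ, ← aeval_testDeriv]
  refine integral_congr_ae (ae_of_all _ fun t => ?_)
  by_cases ht : t ∈ Icc a b
  · simp only [hw j ht]
  · have h0 : (aeval (testDeriv a b) ((H i j).comp (-X)) φ).1 t = 0 :=
      image_eq_zero_of_notMem_tsupport fun h => ht (Ioo_subset_Icc_self (testFn_tsupport _ h))
    simp only [h0, mul_zero]

/-- Every solution of class `C^m` is approximated, on every compact subinterval and with its
derivatives of order at most `m`, by images of smooth functions of compact support under the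
parametrization. -/
theorem exists_polyDiff_approx_of_mem_sol {n q m : ℕ} {H : Matrix (Fin n) (Fin q) ℝ[X]}
    {Q : Matrix (Fin n) (Fin n) ℝ[X]} {V : Matrix (Fin q) (Fin q) ℝ[X]}
    {D : Matrix (Fin n) (Fin q) ℝ[X]} (hH : IsControllable H) (hD : IsSmithForm H Q V D)
    {S : Set ℝ} (hSu : UniqueDiffOn ℝ S) {z : CmSpace S m q} (hz : z ∈ sol S m H) (hab : a < b)
    (hS : Icc a b ⊆ S) {ε : ℝ} (hε : 0 < ε) :
    ∃ γ : ZeroCol D → ℝ → ℝ, (∀ i, ContDiff ℝ (⊤ : ℕ∞) (γ i)) ∧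
      (∀ i, HasCompactSupport (γ i)) ∧ ∀ j, ∀ k ≤ m, ∀ t ∈ Icc a b,
        |iteratedDeriv k (fun t => ∑ i, polyDiff (parametrization V D j i) (γ i) t) t
          - iteratedDerivWithin k (ext fun s => z.1 s j) S t| ≤ ε := by
  classical
  choose w hw hwz using fun j => exists_contDiff_extension hab ((z.2 j).mono hS)
  have h0 := polyAct_eq_zero_of_mem_sol hz hS (w := fun j => ⟨w j, (hw j).continuous⟩) hwz
  obtain ⟨y, hy⟩ := exists_eq_polyAct_parametrization hH hD _ h0
  obtain ⟨U, hU⟩ := exists_leftInverse_parametrization hD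
  obtain ⟨γ, h1, h2, h3⟩ := exists_polyDiff_approx hab hU hw hy hε
  refine ⟨γ, h1, h2, fun j k hk t ht => ?_⟩
  have hu : UniqueDiffOn ℝ (Icc a b) := uniqueDiffOn_Icc hab
  have hkm : (k : WithTop ℕ∞) ≤ m := by exact_mod_cast hk
  have h4 : iteratedDerivWithin k (ext fun s => z.1 s j) S t = iteratedDeriv k (w j) t := by
    rw [← iteratedDerivWithin_eq_iteratedDeriv hu ((hw j).of_le hkm).contDiffAt ht,
      iteratedDerivWithin_congr (hwz j) ht, iteratedDerivWithin, iteratedDerivWithin,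
      iteratedFDerivWithin_subset hS hu hSu ((z.2 j).of_le hkm) ht]
  rw [h4]
  exact h3 j k hk t ht

end Interval

section Causal

/-! ### A feature map for the Matérn kernel -/

theorem integrableOn_pow_mul_exp {c : ℝ} (hc : 0 < c) (n : ℕ) :
    IntegrableOn (fun y : ℝ => y ^ n * Real.exp (-(c * y))) (Ioi 0) := by
  have h := integrableOn_rpow_mul_exp_neg_mul_rpow (p := 1) (s := n) (b := c)
    (by have : (0 : ℝ) ≤ n := Nat.cast_nonneg n; linarith) one_pos hc
  refine h.congr_fun (fun y _ => ?_) measurableSet_Ioi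
  simp

theorem integral_pow_mul_exp {c : ℝ} (hc : 0 < c) (n : ℕ) :
    ∫ y in Ioi (0 : ℝ), y ^ n * Real.exp (-(c * y)) = n.factorial / c ^ (n + 1) := by
  have h := Real.integral_rpow_mul_exp_neg_mul_Ioi (a := n + 1) (r := c) (by positivity) hc
  rw [Real.Gamma_nat_eq_factorial] at h
  have h2 : (1 / c) ^ ((n : ℝ) + 1) = (1 / c) ^ (n + 1) := by
    rw [← Real.rpow_natCast]; push_cast; rfl
  rw [h2] at h
  rw [div_eq_mul_inv, mul_comm, ← inv_pow, ← one_div, ← h]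
  refine setIntegral_congr_fun measurableSet_Ioi fun y _ => ?_
  simp

/-- The causal function `x ↦ (t - x)₊ ^ j * exp (α x)`, with the convention that it vanishes for
`x ≥ t` also when `j = 0`. -/
def causal (α : ℝ) (j : ℕ) (t : ℝ) : ℝ → ℝ :=
  (Iio t).indicator fun x => (t - x) ^ j * Real.exp (α * x)

theorem measurable_causal (α : ℝ) (j : ℕ) (t : ℝ) : Measurable (causal α j t) :=
  Measurable.indicator (by fun_prop) measurableSet_Iio

theorem causal_mul_causal_comp (α : ℝ) (i j : ℕ) {s t : ℝ} (hts : t ≤ s) (y : ℝ) :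
    causal α i s (t - y) * causal α j t (t - y) = (Ioi 0).indicator (fun y =>
      ∑ l ∈ Finset.range (i + 1), (i.choose l * (s - t) ^ (i - l) * Real.exp (2 * α * t)) *
        (y ^ (l + j) * Real.exp (-(2 * α * y)))) y := by
  by_cases hy : 0 < y
  · have h1 : t - y ∈ Iio s := by simp only [mem_Iio]; linarith
    have h2 : t - y ∈ Iio t := by simp only [mem_Iio]; linarith
    rw [causal, causal, indicator_of_mem h1, indicator_of_mem h2, indicator_of_mem (mem_Ioi.mpr hy)]
    have h3 : (s - (t - y)) ^ i =
        ∑ l ∈ Finset.range (i + 1), y ^ l * (s - t) ^ (i - l) * i.choose l := by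
      rw [← add_pow]
      ring
    have h4 : Real.exp (2 * α * t) * Real.exp (-(2 * α * y)) =
        Real.exp (α * (t - y)) * Real.exp (α * (t - y)) := by
      rw [← Real.exp_add, ← Real.exp_add]
      ring_nf
    rw [h3, sub_sub_cancel, Finset.sum_mul, Finset.sum_mul]
    refine Finset.sum_congr rfl fun l _ => ?_
    rw [pow_add]
    linear_combination (-(i.choose l : ℝ) * (s - t) ^ (i - l) * y ^ l * y ^ j) * h4
  · have h2 : t - y ∉ Iio t := by simp only [mem_Iio]; linarith
    have h3 : y ∉ Ioi (0 : ℝ) := hy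
    rw [causal, causal, indicator_of_notMem h2, indicator_of_notMem h3, mul_zero]

variable {α : ℝ}

theorem integrable_causal_mul (hα : 0 < α) (i j : ℕ) {s t : ℝ} (hts : t ≤ s) :
    Integrable fun x => causal α i s x * causal α j t x := by
  rw [← integrable_comp_sub_left (fun x => causal α i s x * causal α j t x) t]
  simp only [causal_mul_causal_comp α i j hts]
  rw [integrable_indicator_iff measurableSet_Ioi]
  exact integrable_finsetSum _ fun l _ =>
    (integrableOn_pow_mul_exp (by linarith : 0 < 2 * α) (l + j)).const_mul _

theorem integral_causal_mul (hα : 0 < α) (i j : ℕ) {s t : ℝ} (hts : t ≤ s) :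
    ∫ x, causal α i s x * causal α j t x = ∑ l ∈ Finset.range (i + 1),
      (i.choose l * (s - t) ^ (i - l) * Real.exp (2 * α * t)) *
        ((l + j).factorial / (2 * α) ^ (l + j + 1)) := by
  rw [← integral_sub_left_eq_self (fun x => causal α i s x * causal α j t x) volume t]
  simp only [causal_mul_causal_comp α i j hts]
  rw [integral_indicator measurableSet_Ioi, integral_finsetSum _ fun l _ =>
    (integrableOn_pow_mul_exp (by linarith : 0 < 2 * α) (l + j)).const_mul _]
  refine Finset.sum_congr rfl fun l _ => ?_
  rw [integral_const_mul, integral_pow_mul_exp (by linarith)]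

theorem memLp_causal (hα : 0 < α) (j : ℕ) (t : ℝ) : MemLp (causal α j t) 2 volume := by
  rw [memLp_two_iff_integrable_sq (measurable_causal α j t).aestronglyMeasurable]
  simpa only [sq] using integrable_causal_mul hα j j (le_refl t)

/-- The Hilbert space in which the feature map takes its values. -/
abbrev FeatureSpace : Type := Lp ℝ 2 (volume : Measure ℝ)

/-- `causal α j t` as an element of `L²(ℝ)`. -/
def causalLp (hα : 0 < α) (j : ℕ) (t : ℝ) : FeatureSpace := (memLp_causal hα j t).toLp _

theorem causalLp_coe (hα : 0 < α) (j : ℕ) (t : ℝ) : causalLp hα j t =ᵐ[volume] causal α j t :=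
  (memLp_causal hα j t).coeFn_toLp

theorem inner_causalLp_left (hα : 0 < α) (g : FeatureSpace) (j : ℕ) (t : ℝ) :
    inner ℝ g (causalLp hα j t) = ∫ x, g x * causal α j t x := by
  rw [L2.inner_def]
  refine integral_congr_ae ?_
  filter_upwards [causalLp_coe hα j t] with x hx
  rw [hx]
  simp [mul_comm]

theorem inner_causalLp (hα : 0 < α) (i j : ℕ) (s t : ℝ) :
    inner ℝ (causalLp hα i s) (causalLp hα j t) = ∫ x, causal α i s x * causal α j t x := by
  rw [inner_causalLp_left]
  refine integral_congr_ae ?_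
  filter_upwards [causalLp_coe hα i s] with x hx
  rw [hx]

theorem pow_succ_add_le {u v : ℝ} (hu : 0 ≤ u) (hv : 0 ≤ v) (n : ℕ) :
    u ^ (n + 1) + (n + 1) * u ^ n * (v - u) ≤ v ^ (n + 1) := by
  induction n with
  | zero => simp
  | succ n ih =>
    have h1 := mul_le_mul_of_nonneg_left ih hv
    have h2 : 0 ≤ (n + 1) * u ^ n * (v - u) ^ 2 := by positivity
    push_cast
    calc u ^ (n + 1 + 1) + (n + 1 + 1) * u ^ (n + 1) * (v - u)
        = v * (u ^ (n + 1) + (n + 1) * u ^ n * (v - u)) - (n + 1) * u ^ n * (v - u) ^ 2 := by ring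
      _ ≤ v * v ^ (n + 1) := by linarith
      _ = v ^ (n + 1 + 1) := by ring

/-- The first-order Taylor remainder of `causal α (j + 1)` in `t` is dominated, pointwise in `x`,
by the increment of its derivative. -/
theorem abs_causal_remainder_le (α : ℝ) (j : ℕ) (t t' x : ℝ) :
    |causal α (j + 1) t' x - causal α (j + 1) t x - (t' - t) * ((j + 1) * causal α j t x)| ≤
      ((j + 1) * |t' - t|) * |causal α j t' x - causal α j t x| := by
  have he : 0 < Real.exp (α * x) := Real.exp_pos _
  have hj : (1 : ℝ) ≤ j + 1 := by
    have : (0 : ℝ) ≤ j := Nat.cast_nonneg j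
    linarith
  by_cases h1 : x < t <;> by_cases h2 : x < t'
  · simp only [causal, indicator_of_mem (mem_Iio.mpr h1), indicator_of_mem (mem_Iio.mpr h2)]
    have hu : 0 ≤ t - x := by linarith
    have hv : 0 ≤ t' - x := by linarith
    have e1 := pow_succ_add_le hu hv j
    have e2 := pow_succ_add_le hv hu j
    have e3 : |(t' - x) ^ (j + 1) - (t - x) ^ (j + 1) - (t' - t) * ((j + 1) * (t - x) ^ j)| ≤
        ((j + 1) * |t' - t|) * |(t' - x) ^ j - (t - x) ^ j| := by
      rw [abs_of_nonneg (by linarith), mul_assoc, ← abs_mul]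
      calc (t' - x) ^ (j + 1) - (t - x) ^ (j + 1) - (t' - t) * ((j + 1) * (t - x) ^ j)
          ≤ (j + 1) * ((t' - t) * ((t' - x) ^ j - (t - x) ^ j)) := by linarith
        _ ≤ _ := mul_le_mul_of_nonneg_left (le_abs_self _) (by linarith)
    calc _ = |((t' - x) ^ (j + 1) - (t - x) ^ (j + 1) - (t' - t) * ((j + 1) * (t - x) ^ j)) *
          Real.exp (α * x)| := by ring_nf
      _ = |(t' - x) ^ (j + 1) - (t - x) ^ (j + 1) - (t' - t) * ((j + 1) * (t - x) ^ j)| *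
          Real.exp (α * x) := by rw [abs_mul, abs_of_pos he]
      _ ≤ (((j + 1) * |t' - t|) * |(t' - x) ^ j - (t - x) ^ j|) * Real.exp (α * x) :=
          mul_le_mul_of_nonneg_right e3 he.le
      _ = _ := by rw [← sub_mul, abs_mul, abs_of_pos he]; ring
  · have h2' : x ∉ Iio t' := h2
    simp only [causal, indicator_of_mem (mem_Iio.mpr h1), indicator_of_notMem h2', zero_sub]
    have hu : 0 < t - x := by linarith
    have hE : 0 ≤ (t - x) ^ j * Real.exp (α * x) := by positivity
    have h3 : t' ≤ x := not_lt.mp h2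
    rw [abs_neg, abs_of_nonneg hE, abs_of_neg (by linarith : t' - t < 0)]
    have h4 : -((t - x) ^ (j + 1) * Real.exp (α * x)) -
        (t' - t) * ((j + 1) * ((t - x) ^ j * Real.exp (α * x))) =
        ((j + 1) * (t - t') - (t - x)) * ((t - x) ^ j * Real.exp (α * x)) := by ring
    have h5 : t - x ≤ (j + 1) * (t - t') := by nlinarith
    rw [h4, abs_of_nonneg (mul_nonneg (by linarith) hE)]
    exact mul_le_mul_of_nonneg_right (by linarith) hE
  · have h1' : x ∉ Iio t := h1
    simp only [causal, indicator_of_mem (mem_Iio.mpr h2), indicator_of_notMem h1', mul_zero,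
      sub_zero]
    have hu : 0 < t' - x := by linarith
    have hE : 0 ≤ (t' - x) ^ j * Real.exp (α * x) := by positivity
    have h3 : t ≤ x := not_lt.mp h1
    rw [abs_of_nonneg hE, abs_of_pos (by linarith : 0 < t' - t), pow_succ,
      abs_of_nonneg (by positivity)]
    have h5 : t' - x ≤ (j + 1) * (t' - t) := by nlinarith
    calc (t' - x) ^ j * (t' - x) * Real.exp (α * x)
        = (t' - x) * ((t' - x) ^ j * Real.exp (α * x)) := by ring
      _ ≤ _ := mul_le_mul_of_nonneg_right h5 hE
  · have h1' : x ∉ Iio t := h1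
    have h2' : x ∉ Iio t' := h2
    simp [causal, indicator_of_notMem h1', indicator_of_notMem h2']

theorem norm_causalLp_remainder_le (hα : 0 < α) (j : ℕ) (t t' : ℝ) :
    ‖causalLp hα (j + 1) t' - causalLp hα (j + 1) t -
      (t' - t) • ((j + 1 : ℝ) • causalLp hα j t)‖ ≤
      ((j + 1) * |t' - t|) * ‖causalLp hα j t' - causalLp hα j t‖ := by
  refine Lp.norm_le_mul_norm_of_ae_le_mul ?_
  filter_upwards [causalLp_coe hα (j + 1) t', causalLp_coe hα (j + 1) t, causalLp_coe hα j t',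
    causalLp_coe hα j t,
    Lp.coeFn_sub (causalLp hα (j + 1) t' - causalLp hα (j + 1) t)
      ((t' - t) • ((j + 1 : ℝ) • causalLp hα j t)),
    Lp.coeFn_sub (causalLp hα (j + 1) t') (causalLp hα (j + 1) t),
    Lp.coeFn_smul (t' - t) ((j + 1 : ℝ) • causalLp hα j t),
    Lp.coeFn_smul (j + 1 : ℝ) (causalLp hα j t),
    Lp.coeFn_sub (causalLp hα j t') (causalLp hα j t)] with x h1 h2 h3 h4 h5 h6 h7 h8 h9
  rw [h5, Pi.sub_apply, h6, Pi.sub_apply, h7, Pi.smul_apply, h8, Pi.smul_apply, h9, Pi.sub_apply,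
    h1, h2, h3, h4]
  exact abs_causal_remainder_le α j t t' x

theorem hasDerivAt_causalLp_of_continuousAt (hα : 0 < α) (j : ℕ) {t : ℝ}
    (h : ContinuousAt (causalLp hα j) t) :
    HasDerivAt (causalLp hα (j + 1)) ((j + 1 : ℝ) • causalLp hα j t) t := by
  rw [hasDerivAt_iff_isLittleO, Asymptotics.isLittleO_iff]
  intro c hc
  have hj : (0 : ℝ) < j + 1 := by positivity
  have h1 : ∀ᶠ t' in 𝓝 t, ‖causalLp hα j t' - causalLp hα j t‖ < c / (j + 1) := by
    have := (tendsto_iff_norm_sub_tendsto_zero.mp h)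
    exact this.eventually (gt_mem_nhds (div_pos hc hj))
  filter_upwards [h1] with t' ht'
  refine (norm_causalLp_remainder_le hα j t t').trans ?_
  rw [lt_div_iff₀ hj] at ht'
  rw [Real.norm_eq_abs]
  calc (j + 1) * |t' - t| * ‖causalLp hα j t' - causalLp hα j t‖
      = (‖causalLp hα j t' - causalLp hα j t‖ * (j + 1)) * |t' - t| := by ring
    _ ≤ c * |t' - t| := mul_le_mul_of_nonneg_right ht'.le (abs_nonneg _)

theorem continuous_causalLp_zero (hα : 0 < α) : Continuous (causalLp hα 0) := by
  have hin : ∀ s t, t ≤ s → inner ℝ (causalLp hα 0 s) (causalLp hα 0 t) =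
      Real.exp (2 * α * t) / (2 * α) := by
    intro s t hts
    rw [inner_causalLp, integral_causal_mul hα 0 0 hts]
    simp
    ring
  have hnorm : ∀ s t, t ≤ s → ‖causalLp hα 0 s - causalLp hα 0 t‖ ^ 2 =
      |Real.exp (2 * α * s) - Real.exp (2 * α * t)| / (2 * α) := by
    intro s t hts
    rw [norm_sub_sq_real, ← real_inner_self_eq_norm_sq, ← real_inner_self_eq_norm_sq,
      hin s s le_rfl, hin t t le_rfl, hin s t hts, abs_of_nonneg]
    · ring
    · rw [sub_nonneg, Real.exp_le_exp]
      nlinarith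
  have hnorm' : ∀ s t, ‖causalLp hα 0 s - causalLp hα 0 t‖ =
      Real.sqrt (|Real.exp (2 * α * s) - Real.exp (2 * α * t)| / (2 * α)) := by
    intro s t
    rw [eq_comm, Real.sqrt_eq_iff_mul_self_eq (by positivity) (norm_nonneg _), ← sq]
    rcases le_total t s with h | h
    · exact (hnorm s t h).symm
    · rw [norm_sub_rev, abs_sub_comm]
      exact (hnorm t s h).symm
  refine continuous_iff_continuousAt.mpr fun t => tendsto_iff_norm_sub_tendsto_zero.mpr ?_
  simp only [hnorm']
  have : Continuous fun s =>
      Real.sqrt (|Real.exp (2 * α * s) - Real.exp (2 * α * t)| / (2 * α)) := by fun_prop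
  simpa using this.tendsto t

theorem continuous_causalLp (hα : 0 < α) (j : ℕ) : Continuous (causalLp hα j) := by
  induction j with
  | zero => exact continuous_causalLp_zero hα
  | succ j ih =>
    exact continuous_iff_continuousAt.mpr fun t =>
      (hasDerivAt_causalLp_of_continuousAt hα j ih.continuousAt).continuousAt

theorem hasDerivAt_causalLp (hα : 0 < α) (j : ℕ) (t : ℝ) :
    HasDerivAt (causalLp hα (j + 1)) ((j + 1 : ℝ) • causalLp hα j t) t :=
  hasDerivAt_causalLp_of_continuousAt hα j (continuous_causalLp hα j).continuousAt

theorem contDiff_causalLp (hα : 0 < α) (j : ℕ) : ContDiff ℝ j (causalLp hα j) := by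
  induction j with
  | zero => exact contDiff_zero.mpr (continuous_causalLp hα 0)
  | succ j ih =>
    have hd : deriv (causalLp hα (j + 1)) = fun t => (j + 1 : ℝ) • causalLp hα j t :=
      funext fun t => (hasDerivAt_causalLp hα j t).deriv
    have : ContDiff ℝ ((j : WithTop ℕ∞) + 1) (causalLp hα (j + 1)) := by
      refine contDiff_succ_iff_deriv.mpr
        ⟨fun t => (hasDerivAt_causalLp hα j t).differentiableAt, by simp, ?_⟩
      rw [hd]
      exact ih.const_smul _
    exact_mod_cast this

/-- Smooth functions of compact support are represented by `causalLp`: this is Taylor's formula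
with integral remainder. -/
theorem exists_inner_causalLp_eq (hα : 0 < α) (r : ℕ) {f : ℝ → ℝ} (hf : ContDiff ℝ (⊤ : ℕ∞) f)
    (hc : HasCompactSupport f) : ∃ g : FeatureSpace, ∀ t, inner ℝ g (causalLp hα r t) = f t := by
  have hfk : ∀ k, ContDiff ℝ (⊤ : ℕ∞) (iteratedDeriv k f) := fun k => by
    rw [← polyDiff_X_pow]
    exact contDiff_infty_polyDiff _ hf
  have hck : ∀ k, HasCompactSupport (iteratedDeriv k f) := fun k => by
    rw [← polyDiff_X_pow]
    exact hasCompactSupport_polyDiff _ hc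
  let g₀ : ℝ → ℝ := fun x => iteratedDeriv (r + 1) f x * (Real.exp (-(α * x)) / r.factorial)
  have hg₀ : MemLp g₀ 2 volume := by
    refine Continuous.memLp_of_hasCompactSupport ?_ (hck _).mul_right
    exact (hfk _).continuous.mul (by fun_prop)
  have hg₀c : hg₀.toLp g₀ =ᵐ[volume] g₀ := hg₀.coeFn_toLp
  have hin : ∀ j t, inner ℝ (hg₀.toLp g₀) (causalLp hα j t) =
      ∫ x in Iic t, (iteratedDeriv (r + 1) f x / r.factorial) * (t - x) ^ j := by
    intro j t
    rw [inner_causalLp_left, integral_Iic_eq_integral_Iio, ← integral_indicator measurableSet_Iio]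
    refine integral_congr_ae ?_
    filter_upwards [hg₀c] with x hx
    rw [hx]
    by_cases h : x ∈ Iio t
    · simp only [causal, indicator_of_mem h, g₀]
      have : Real.exp (-(α * x)) * Real.exp (α * x) = 1 := by
        rw [← Real.exp_add]; simp
      linear_combination (iteratedDeriv (r + 1) f x / r.factorial * (t - x) ^ j) * this
    · simp only [causal, indicator_of_notMem h, mul_zero]
  -- a point to the left of the support
  obtain ⟨c, hcl⟩ : ∃ c, ∀ k, ∀ t ≤ c, iteratedDeriv k f t = 0 := by
    obtain ⟨c, hc⟩ := hc.isCompact.bddBelow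
    refine ⟨c - 1, fun k t ht => ?_⟩
    have h1 : EqOn f (fun _ => 0) (tsupport f)ᶜ := fun s hs => image_eq_zero_of_notMem_tsupport hs
    rw [iteratedDeriv_eqOn (isClosed_tsupport f).isOpen_compl h1 k
      (fun h => by have := hc h; linarith : t ∈ (tsupport f)ᶜ)]
    simp
  -- both sides have the same derivative in `t`, by induction on `j`, and vanish for `t ≤ c`
  have key : ∀ j ≤ r, ∀ t, inner ℝ (hg₀.toLp g₀) (causalLp hα j t) =
      (j.factorial / r.factorial) * iteratedDeriv (r - j) f t := by
    intro j
    induction j with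
    | zero =>
      intro _ t
      rw [hin]
      simp only [pow_zero, mul_one]
      rw [integral_div, iteratedDeriv_succ, HasCompactSupport.integral_Iic_deriv_eq
        ((hfk r).of_le (by exact_mod_cast le_top)) (hck r)]
      simp only [Nat.factorial_zero, Nat.cast_one, Nat.sub_zero]
      ring
    | succ j ih =>
      intro hj t
      let F : ℝ → ℝ := fun t => inner ℝ (hg₀.toLp g₀) (causalLp hα (j + 1) t) -
        ((j + 1).factorial / r.factorial) * iteratedDeriv (r - (j + 1)) f t
      have hF : ∀ t, HasDerivAt F 0 t := by
        intro t
        have h1 := ((hasDerivAt_const t (hg₀.toLp g₀)).inner ℝ (hasDerivAt_causalLp hα j t))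
        have h2 := (hasDerivAt_of_contDiff (hfk (r - (j + 1))) (by simp) t).const_mul
          ((j + 1).factorial / r.factorial : ℝ)
        refine (h1.sub h2).congr_deriv ?_
        rw [inner_zero_left, add_zero, inner_smul_right, ih (by omega), ← iteratedDeriv_succ,
          show r - (j + 1) + 1 = r - j by omega, Nat.factorial_succ]
        push_cast
        ring
      have h1 := is_const_of_deriv_eq_zero (fun t => (hF t).differentiableAt)
        (fun t => (hF t).deriv) t (min t c)
      have h2 : F (min t c) = 0 := by
        have hm : min t c ≤ c := min_le_right _ _
        simp only [F]
        rw [hcl _ _ hm, hin, setIntegral_eq_zero_of_forall_eq_zero]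
        · ring
        · intro x hx
          rw [hcl _ _ ((mem_Iic.mp hx).trans hm)]
          simp
      rw [h2] at h1
      exact sub_eq_zero.mp h1
  refine ⟨hg₀.toLp g₀, fun t => ?_⟩
  rw [key r le_rfl t, Nat.sub_self, iteratedDeriv_zero, div_self (by positivity), one_mul]

/-- The feature map of the Matérn kernel. -/
def maternFeature (σ : ℝ) (hα : 0 < α) (r : ℕ) (t : ℝ) : FeatureSpace :=
  (Real.sqrt (σ ^ 2 * (2 * α) ^ (2 * r + 1) / (2 * r).factorial) * Real.exp (-(α * t))) •
    causalLp hα r t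

theorem contDiff_maternFeature (σ : ℝ) (hα : 0 < α) (r : ℕ) :
    ContDiff ℝ r (maternFeature σ hα r) := by
  have h : ContDiff ℝ r fun t =>
      Real.sqrt (σ ^ 2 * (2 * α) ^ (2 * r + 1) / (2 * r).factorial) * Real.exp (-(α * t)) := by
    fun_prop
  exact h.smul (contDiff_causalLp hα r)

theorem inner_maternFeature {σ ℓ : ℝ} (hα : 0 < α) {r : ℕ}
    (h : α = Real.sqrt (2 * r + 1) / ℓ) (s t : ℝ) :
    inner ℝ (maternFeature σ hα r s) (maternFeature σ hα r t) = matern σ ℓ r s t := by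
  wlog hts : t ≤ s generalizing s t
  · rw [real_inner_comm, this t s (by linarith), matern, matern, abs_sub_comm]
  rw [maternFeature, maternFeature, inner_smul_left, inner_smul_right, inner_causalLp,
    integral_causal_mul hα r r hts, matern, abs_of_nonneg (sub_nonneg.mpr hts)]
  have h1 : Real.sqrt (2 * r + 1) * (s - t) / ℓ = α * (s - t) := by rw [h]; ring
  have h2 : 2 * Real.sqrt (2 * r + 1) * (s - t) / ℓ = 2 * α * (s - t) := by rw [h]; ring
  rw [h1, h2]
  have hC : 0 ≤ σ ^ 2 * (2 * α) ^ (2 * r + 1) / (2 * r).factorial := by positivity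
  have hexp : Real.exp (-(α * s)) * Real.exp (-(α * t)) * Real.exp (2 * α * t) =
      Real.exp (-(α * (s - t))) := by
    rw [← Real.exp_add, ← Real.exp_add]
    ring_nf
  have hsq := Real.mul_self_sqrt hC
  set B := Real.sqrt (σ ^ 2 * (2 * α) ^ (2 * r + 1) / (2 * r).factorial)
  simp only [conj_trivial]
  rw [Finset.mul_sum, Finset.mul_sum, Finset.mul_sum, Finset.mul_sum]
  refine Finset.sum_congr rfl fun l hl => ?_
  have hl' : l ≤ r := Nat.le_of_lt_succ (Finset.mem_range.mp hl)
  rw [← hexp]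
  have hch : (r.choose l : ℝ) = r.factorial / (l.factorial * (r - l).factorial) :=
    Nat.cast_choose ℝ hl'
  have hpow : (2 * α) ^ (2 * r + 1) = (2 * α) ^ (r - l) * (2 * α) ^ (l + r + 1) := by
    rw [← pow_add]
    congr 1
    omega
  have hne : (2 * α) ^ (l + r + 1) ≠ 0 := by positivity
  calc _ = (B * B) * (Real.exp (-(α * s)) * Real.exp (-(α * t)) * Real.exp (2 * α * t)) *
        (r.choose l * (s - t) ^ (r - l) * ((l + r).factorial / (2 * α) ^ (l + r + 1))) := by ring
    _ = _ := by
      rw [hsq, hpow, hch, mul_pow (2 * α) (s - t), add_comm l r]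
      field_simp

theorem exists_inner_maternFeature_eq {σ : ℝ} (hσ : 0 < σ) (hα : 0 < α) (r : ℕ) {f : ℝ → ℝ}
    (hf : ContDiff ℝ (⊤ : ℕ∞) f) (hc : HasCompactSupport f) :
    ∃ g : FeatureSpace, ∀ t, inner ℝ g (maternFeature σ hα r t) = f t := by
  have hB : 0 < Real.sqrt (σ ^ 2 * (2 * α) ^ (2 * r + 1) / (2 * r).factorial) := by positivity
  set B := Real.sqrt (σ ^ 2 * (2 * α) ^ (2 * r + 1) / (2 * r).factorial) with hBdef
  have h1 : ContDiff ℝ (⊤ : ℕ∞) fun t => f t * (Real.exp (α * t) / B) :=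
    hf.mul (by fun_prop)
  obtain ⟨g, hg⟩ := exists_inner_causalLp_eq hα r h1 hc.mul_right
  refine ⟨g, fun t => ?_⟩
  rw [maternFeature, inner_smul_right, hg, ← hBdef]
  have : Real.exp (-(α * t)) * Real.exp (α * t) = 1 := by rw [← Real.exp_add]; simp
  field_simp
  linear_combination f t * this

end Causal

/-! ### Reproducing kernel Hilbert spaces and feature maps -/

section Rkhs

variable {T F : Type} [NormedAddCommGroup F] [InnerProductSpace ℝ F] [CompleteSpace F]

/-- The elements of a reproducing kernel Hilbert space are represented by any feature map of its
kernel: the Hilbert space embeds isometrically into the feature space. -/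
theorem exists_inner_eq_of_mem_rkhs {k : T → T → ℝ} {Φ : T → F}
    (hk : ∀ s t, inner ℝ (Φ s) (Φ t) = k s t) {f : T → ℝ} (hf : f ∈ rkhs k) :
    ∃ g : F, ∀ t, f t = inner ℝ g (Φ t) := by
  obtain ⟨E, _, _, _, _, hE, f, rfl⟩ := hf
  let κ : T → E := fun t => RKHS.kerFun E t 1
  have hκ : ∀ s t, inner ℝ (κ s) (κ t) = k s t := by
    intro s t
    rw [← hE s t, RKHS.kerFun_inner, RKHS.kerFun_apply]
    simp
  let A : (T →₀ ℝ) →ₗ[ℝ] E := Finsupp.linearCombination ℝ κ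
  let B : (T →₀ ℝ) →ₗ[ℝ] F := Finsupp.linearCombination ℝ Φ
  have hAB : ∀ c d, inner ℝ (A c) (A d) = inner ℝ (B c) (B d) := by
    intro c d
    simp only [A, B, Finsupp.linearCombination_apply, Finsupp.sum, sum_inner, inner_sum,
      inner_smul_left, inner_smul_right, hκ, hk]
  have hnorm : ∀ c, ‖B c‖ ≤ 1 * ‖A c‖ := by
    intro c
    rw [one_mul, ← sq_le_sq₀ (norm_nonneg _) (norm_nonneg _), ← real_inner_self_eq_norm_sq,
      ← real_inner_self_eq_norm_sq, hAB]
  have hdense : DenseRange A := by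
    have h1 : (LinearMap.range A : Set E) = Set.range A := LinearMap.coe_range A
    rw [DenseRange, ← h1, Submodule.dense_iff_topologicalClosure_eq_top, eq_top_iff,
      ← RKHS.kerFun_dense E]
    refine Submodule.topologicalClosure_mono (Submodule.span_le.mpr ?_)
    rintro _ ⟨t, v, rfl⟩
    refine ⟨Finsupp.single t v, ?_⟩
    simp only [A, Finsupp.linearCombination_single, κ]
    rw [← map_smul, smul_eq_mul, mul_one]
  let J : E →L[ℝ] F := B.extendOfNorm A
  have hJ : ∀ c, J (A c) = B c := fun c => LinearMap.extendOfNorm_eq hdense ⟨1, hnorm⟩ c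
  refine ⟨J f, fun t => ?_⟩
  have h1 : inner ℝ f (κ t) = inner ℝ (J f) (Φ t) := by
    refine hdense.induction_on (p := fun f => inner ℝ f (κ t) = inner ℝ (J f) (Φ t)) f
      (isClosed_eq (by fun_prop) (by fun_prop)) fun c => ?_
    have h2 := hAB c (Finsupp.single t 1)
    simp only [A, B, Finsupp.linearCombination_single, one_smul] at h2
    rw [hJ]
    exact h2
  rw [← h1, RKHS.inner_kerFun]
  simp

/-- Functions represented by a feature map of the kernel belong to the reproducing kernel Hilbert
space, which is realized as the closed span of the features. -/
theorem mem_rkhs_of_eq_inner {k : T → T → ℝ} {Φ : T → F}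
    (hk : ∀ s t, inner ℝ (Φ s) (Φ t) = k s t) (g : F) :
    (fun t => inner ℝ g (Φ t)) ∈ rkhs k := by
  let K : Submodule ℝ F := (Submodule.span ℝ (range Φ)).topologicalClosure
  have hKc : IsClosed (K : Set F) := Submodule.isClosed_topologicalClosure _
  have : CompleteSpace K := hKc.completeSpace_coe
  have hΦ : ∀ t, Φ t ∈ K := fun t =>
    Submodule.le_topologicalClosure _ (Submodule.subset_span (mem_range_self t))
  let coe : K →L[ℝ] T → ℝ := ContinuousLinearMap.pi fun t => (innerSL ℝ (Φ t)).comp K.subtypeL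
  have hcoe : ∀ x t, coe x t = inner ℝ (Φ t) (x : F) := fun _ _ => rfl
  let inst : RKHS ℝ K T ℝ :=
    { coeCLM := coe
      coeCLM_injective := by
        refine (injective_iff_map_eq_zero _).mpr fun x hx => ?_
        have h1 : (x : F) ∈ Kᗮ := by
          rw [Submodule.orthogonal_closure, Submodule.mem_orthogonal]
          intro u hu
          induction hu using Submodule.span_induction with
          | mem u hu =>
            obtain ⟨t, rfl⟩ := hu
            exact congrFun hx t
          | zero => exact inner_zero_left _
          | add u v _ _ hu hv => rw [inner_add_left, hu, hv, add_zero]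
          | smul c u _ hu => rw [inner_smul_left, hu, mul_zero]
        have h2 := Submodule.inner_right_of_mem_orthogonal x.2 h1
        exact Subtype.ext (inner_self_eq_zero.mp h2) }
  refine ⟨K, inferInstance, inferInstance, inferInstance, inst, fun s t => ?_,
    K.orthogonalProjectionOnto g, ?_⟩
  · have hker : ∀ t, RKHS.kerFun K t (1 : ℝ) = ⟨Φ t, hΦ t⟩ := by
      intro t
      refine ext_inner_right ℝ fun x => ?_
      have h1 : ∀ c : ℝ, inner ℝ (1 : ℝ) c = c := fun c => by simp
      rw [RKHS.kerFun_inner, h1]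
      rfl
    rw [← RKHS.kerFun_apply, hker, ← hk]
    rfl
  · funext t
    change inner ℝ (Φ t) ((K.orthogonalProjectionOnto g : K) : F) = inner ℝ g (Φ t)
    have h := K.inner_orthogonalProjectionOnto_eq_of_mem_left ⟨Φ t, hΦ t⟩ g
    exact h.trans (real_inner_comm _ _)

end Rkhs

/-! ### Images of the RKHS and posterior means in terms of a feature map -/

theorem exists_sum_eq_of_mem_span {E α β : Type*} [AddCommGroup E] [Module ℝ E] [Fintype β]
    {f : α × β → E} {x : E} (hx : x ∈ Submodule.span ℝ (range f)) :
    ∃ (N : ℕ) (τ : Fin N → α) (c : Fin N × β → ℝ), x = ∑ a, c a • f (τ a.1, a.2) := by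
  classical
  obtain ⟨c, rfl⟩ := (Finsupp.mem_span_range_iff_exists_finsupp).mp hx
  let T : Finset α := c.support.image Prod.fst
  let e := T.equivFin
  refine ⟨T.card, fun n => (e.symm n).1, fun a => c ((e.symm a.1).1, a.2), ?_⟩
  rw [Fintype.sum_prod_type]
  have h1 : ∑ n, ∑ l, c ((e.symm n).1, l) • f ((e.symm n).1, l) =
      ∑ s ∈ T, ∑ l, c (s, l) • f (s, l) := by
    rw [← Finset.sum_coe_sort T, Equiv.sum_comp e.symm
      (fun s : T => ∑ l, c (s.1, l) • f (s.1, l))]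
  rw [h1, ← Finset.sum_product', Finsupp.sum]
  refine Finset.sum_subset (fun x hx => ?_) fun x _ hx => ?_
  · exact Finset.mem_product.mpr ⟨Finset.mem_image_of_mem _ hx, Finset.mem_univ _⟩
  · rw [Finsupp.notMem_support_iff.mp hx, zero_smul]

section Feature

variable {F : Type} [NormedAddCommGroup F] [InnerProductSpace ℝ F]
  {q : ℕ} {ι : Type} [Fintype ι]

/-- The vector `(P(∂) Φ)` of row `j` at time `t`: the feature, in the `ι`-fold power of the feature
space, of the `j`-th component at `t` of the process `P g̃`. -/
def rowFeature (P : Matrix (Fin q) ι ℝ[X]) (Φ : ℝ → F) (j : Fin q) (t : ℝ) :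
    PiLp 2 fun _ : ι => F :=
  WithLp.toLp 2 fun i => polyDiff (P j i) Φ t

theorem natDegree_le_opOrder (P : Matrix (Fin q) ι ℝ[X]) (j : Fin q) (i : ι) :
    (P j i).natDegree ≤ opOrder P :=
  (Finset.le_sup (f := fun i => (P j i).natDegree) (Finset.mem_univ i)).trans
    (Finset.le_sup (f := fun j => Finset.univ.sup fun i => (P j i).natDegree) (Finset.mem_univ j))

variable {P : Matrix (Fin q) ι ℝ[X]} {Φ : ℝ → F} {r m : ℕ}

theorem contDiff_rowFeature (hΦ : ContDiff ℝ r Φ) (hm : m + opOrder P ≤ r) (j : Fin q) :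
    ContDiff ℝ m (rowFeature P Φ j) := by
  refine contDiff_piLp' 2 fun i => ?_
  exact contDiff_polyDiff hΦ (by have := natDegree_le_opOrder P j i; omega)

theorem inner_rowFeature (G : PiLp 2 fun _ : ι => F) (j : Fin q) (t : ℝ) :
    inner ℝ G (rowFeature P Φ j t) = ∑ i, inner ℝ (G i) (polyDiff (P j i) Φ t) :=
  PiLp.inner_apply _ _

theorem polyDiff_inner (hΦ : ContDiff ℝ r Φ) {p : ℝ[X]} (hp : p.natDegree ≤ r) (g : F) (t : ℝ) :
    polyDiff p (fun s => inner ℝ g (Φ s)) t = inner ℝ g (polyDiff p Φ t) :=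
  polyDiff_clm (innerSL ℝ g) hΦ hp t

theorem iteratedDeriv_inner {E : Type*} [NormedAddCommGroup E] [InnerProductSpace ℝ E]
    {Ψ : ℝ → E} {k : ℕ} (hΨ : ContDiff ℝ k Ψ) (g : E) (t : ℝ) :
    iteratedDeriv k (fun s => inner ℝ g (Ψ s)) t = inner ℝ g (iteratedDeriv k Ψ t) :=
  iteratedDeriv_clm (innerSL ℝ g) hΨ t

/-- The functions on `S` represented by elements of the power of the feature space. -/
def featureImage (S : Set ℝ) (P : Matrix (Fin q) ι ℝ[X]) (Φ : ℝ → F)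
    (G : PiLp 2 fun _ : ι => F) : S → Fin q → ℝ :=
  fun t j => inner ℝ G (rowFeature P Φ j t)

theorem eqOn_ext_featureImage (S : Set ℝ) (G : PiLp 2 fun _ : ι => F) (j : Fin q) :
    EqOn (ext fun t => featureImage S P Φ G t j) (fun t => inner ℝ G (rowFeature P Φ j t)) S :=
  fun _ ht => ext_apply _ ht

theorem contDiffOn_ext_featureImage (S : Set ℝ) (hΦ : ContDiff ℝ r Φ) (hm : m + opOrder P ≤ r)
    (G : PiLp 2 fun _ : ι => F) (j : Fin q) :
    ContDiffOn ℝ m (ext fun t => featureImage S P Φ G t j) S :=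
  (((innerSL ℝ G).contDiff.comp (contDiff_rowFeature hΦ hm j)).contDiffOn).congr
    (eqOn_ext_featureImage S G j)

theorem iteratedDerivWithin_ext_featureImage {S : Set ℝ} (hS : UniqueDiffOn ℝ S)
    (hΦ : ContDiff ℝ r Φ) (hm : m + opOrder P ≤ r) (G : PiLp 2 fun _ : ι => F) (j : Fin q)
    {k : ℕ} (hk : k ≤ m) {t : ℝ} (ht : t ∈ S) :
    iteratedDerivWithin k (ext fun t => featureImage S P Φ G t j) S t =
      inner ℝ G (iteratedDeriv k (rowFeature P Φ j) t) := by
  have h1 : ContDiff ℝ k (rowFeature P Φ j) := contDiff_rowFeature hΦ (by omega) j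
  have h2 : ContDiff ℝ k fun s => inner ℝ G (rowFeature P Φ j s) := (innerSL ℝ G).contDiff.comp h1
  rw [iteratedDerivWithin_congr (eqOn_ext_featureImage S G j) ht,
    iteratedDerivWithin_eq_iteratedDeriv hS h2.contDiffAt ht, iteratedDeriv_inner h1]

theorem applyOp_eq_featureImage {S : Set ℝ} (hS : UniqueDiffOn ℝ S) (hΦ : ContDiff ℝ r Φ)
    (hP : opOrder P ≤ r) {f : ι → S → ℝ} {G : PiLp 2 fun _ : ι => F}
    (hf : ∀ i (t : S), f i t = inner ℝ (G i) (Φ t)) : applyOp P f = featureImage S P Φ G := by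
  funext t j
  rw [featureImage, inner_rowFeature]
  refine Finset.sum_congr rfl fun i _ => ?_
  have hdeg : (P j i).natDegree ≤ r := (natDegree_le_opOrder P j i).trans hP
  rw [← polyDiff_inner hΦ hdeg, diffOp, polyDiff]
  refine Finset.sum_congr rfl fun k hk => ?_
  have hk' : k ≤ r := (le_natDegree_of_mem_supp k hk).trans hdeg
  have h1 : EqOn (ext (f i)) (fun s => inner ℝ (G i) (Φ s)) S := fun s hs => by
    rw [ext_apply _ hs, hf]
  have h2 : ContDiff ℝ k fun s => inner ℝ (G i) (Φ s) :=
    (innerSL ℝ (G i)).contDiff.comp (hΦ.of_le (by exact_mod_cast hk'))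
  exact congrArg ((P j i).coeff k * ·) ((iteratedDerivWithin_congr h1 t.2).trans
    (iteratedDerivWithin_eq_iteratedDeriv hS h2.contDiffAt t.2))

/-- The image of the RKHS under `P` consists of the functions represented by the features of the
process `P g̃`. -/
theorem mem_opImage_iff [CompleteSpace F] {S : Set ℝ} (hS : UniqueDiffOn ℝ S)
    (hΦ : ContDiff ℝ r Φ) (hP : opOrder P ≤ r) {k : ℝ → ℝ → ℝ}
    (hk : ∀ s t, inner ℝ (Φ s) (Φ t) = k s t) {w : S → Fin q → ℝ} :
    w ∈ opImage S P k ↔ ∃ G, w = featureImage S P Φ G := by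
  have hk' : ∀ s t : S, inner ℝ (Φ s) (Φ t) = k s t := fun s t => hk s t
  constructor
  · rintro ⟨f, hf, rfl⟩
    choose g hg using fun i => exists_inner_eq_of_mem_rkhs hk' (hf i)
    exact ⟨WithLp.toLp 2 g, applyOp_eq_featureImage hS hΦ hP hg⟩
  · rintro ⟨G, rfl⟩
    exact ⟨fun i t => inner ℝ (G i) (Φ t), fun i => mem_rkhs_of_eq_inner hk' (G i),
      (applyOp_eq_featureImage hS hΦ hP fun _ _ => rfl).symm⟩

theorem lodeKernel_eq_inner (hΦ : ContDiff ℝ r Φ) (hP : opOrder P ≤ r) {k : ℝ → ℝ → ℝ}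
    (hk : ∀ s t, inner ℝ (Φ s) (Φ t) = k s t) (s t : ℝ) (j l : Fin q) :
    lodeKernel P k s t j l = inner ℝ (rowFeature P Φ j s) (rowFeature P Φ l t) := by
  rw [inner_rowFeature]
  refine Finset.sum_congr rfl fun i _ => ?_
  have hdeg : ∀ j, (P j i).natDegree ≤ r := fun j => (natDegree_le_opOrder P j i).trans hP
  have h1 : (fun s' => diffOp univ (P l i) (fun t' => k s' t') t) =
      fun s' => inner ℝ (polyDiff (P l i) Φ t) (Φ s') := by
    funext s'
    simp only [← hk]
    rw [diffOp_univ, polyDiff_inner hΦ (hdeg l), real_inner_comm]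
  rw [h1, diffOp_univ, polyDiff_inner hΦ (hdeg j), real_inner_comm]
  rfl

/-- The posterior means are the functions represented by finite linear combinations of features:
since the kernel matrix is positive semidefinite, the matrix `K + v I` is invertible. -/
theorem mem_posteriorMeans_iff (S : Set ℝ) (hΦ : ContDiff ℝ r Φ) (hP : opOrder P ≤ r)
    {k : ℝ → ℝ → ℝ} (hk : ∀ s t, inner ℝ (Φ s) (Φ t) = k s t) {v : ℝ} (hv : 0 < v)
    {w : S → Fin q → ℝ} :
    w ∈ posteriorMeans S (lodeKernel P k) v ↔
      ∃ (N : ℕ) (τ : Fin N → S) (c : Fin N × Fin q → ℝ),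
        w = featureImage S P Φ (∑ a, c a • rowFeature P Φ a.2 (τ a.1)) := by
  have heq : ∀ (N : ℕ) (τ : Fin N → S) (c : Fin N × Fin q → ℝ) (t : S) (j : Fin q),
      featureImage S P Φ (∑ a, c a • rowFeature P Φ a.2 (τ a.1)) t j =
        ∑ a, lodeKernel P k t (τ a.1) j a.2 * c a := by
    intro N τ c t j
    rw [featureImage, sum_inner]
    refine Finset.sum_congr rfl fun a _ => ?_
    rw [inner_smul_left, lodeKernel_eq_inner hΦ hP hk, real_inner_comm]
    simp [mul_comm]
  constructor
  · rintro ⟨N, τ, y, hw⟩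
    exact ⟨N, τ, _, funext fun t => funext fun j => (hw t j).trans (heq _ _ _ _ _).symm⟩
  · rintro ⟨N, τ, c, rfl⟩
    let A : Matrix (Fin N × Fin q) (Fin N × Fin q) ℝ :=
      Matrix.of fun b c : Fin N × Fin q => lodeKernel P k (τ b.1) (τ c.1) b.2 c.2
    have hA : A = Matrix.gram ℝ fun a : Fin N × Fin q => rowFeature P Φ a.2 (τ a.1) := by
      ext b c
      exact lodeKernel_eq_inner hΦ hP hk _ _ _ _
    have hpos : (A + v • (1 : Matrix (Fin N × Fin q) (Fin N × Fin q) ℝ)).PosDef := by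
      rw [hA]
      exact Matrix.PosDef.posSemidef_add (Matrix.posSemidef_gram ℝ _) (Matrix.PosDef.one.smul hv)
    have hdet : IsUnit (A + v • (1 : Matrix (Fin N × Fin q) (Fin N × Fin q) ℝ)).det :=
      (Matrix.isUnit_iff_isUnit_det _).mp hpos.isUnit
    refine ⟨N, τ, (A + v • (1 : Matrix (Fin N × Fin q) (Fin N × Fin q) ℝ)).mulVec c,
      fun t j => ?_⟩
    rw [Matrix.mulVec_mulVec, Matrix.nonsing_inv_mul _ hdet, Matrix.one_mulVec]
    exact heq _ _ _ _ _

end Feature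

/-! ### The topology of `C^m(S, ℝ^q)` -/

/-- A point of `C^m(S, ℝ^q)` is in the closure of a set as soon as it can be approximated by the
set on every compact interval in `S`. -/
theorem mem_closure_of_forall_Icc {S : Set ℝ} (hS : S.OrdConnected) (hS' : S.Nontrivial) {m q : ℕ}
    {z : CmSpace S m q} {A : Set (CmSpace S m q)}
    (h : ∀ a b, a < b → Icc a b ⊆ S → ∀ ε > 0, ∃ w ∈ A, ∀ j, ∀ k ≤ m, ∀ t ∈ Icc a b,
      |iteratedDerivWithin k (ext fun s => w.1 s j) S t
        - iteratedDerivWithin k (ext fun s => z.1 s j) S t| ≤ ε) : z ∈ closure A := by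
  -- every compact subset of `S` is contained in a nondegenerate compact interval
  have hK : ∀ K : TopologicalSpace.Compacts S, ∃ a b, a < b ∧ Icc a b ⊆ S ∧
      ∀ t ∈ K, (t : ℝ) ∈ Icc a b := by
    intro K
    obtain ⟨s₀, h₀, s₁, h₁, hlt⟩ := hS'.exists_lt
    have hc : IsCompact (((↑) : S → ℝ) '' (K : Set S) ∪ {s₀, s₁}) :=
      (K.isCompact.image continuous_subtype_val).union (toFinite _).isCompact
    have hne : (((↑) : S → ℝ) '' (K : Set S) ∪ {s₀, s₁}).Nonempty := ⟨s₀, by simp⟩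
    have hsub : ((↑) : S → ℝ) '' (K : Set S) ∪ {s₀, s₁} ⊆ S := by
      rintro _ (⟨t, -, rfl⟩ | rfl | rfl)
      exacts [t.2, h₀, h₁]
    obtain ⟨a, ha, ha'⟩ := hc.exists_isLeast hne
    obtain ⟨b, hb, hb'⟩ := hc.exists_isGreatest hne
    refine ⟨a, b, ?_, hS.out (hsub ha) (hsub hb), fun t ht => ?_⟩
    · have e1 : a ≤ s₀ := ha' (by simp)
      have e2 : s₁ ≤ b := hb' (by simp)
      linarith
    · have : (t : ℝ) ∈ ((↑) : S → ℝ) '' (K : Set S) ∪ {s₀, s₁} := Or.inl ⟨t, ht, rfl⟩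
      exact ⟨ha' this, hb' this⟩
  have hu : ∀ x : TopologicalSpace.Compacts S × ℕ, ∃ w ∈ A, ∀ j, ∀ k ≤ m, ∀ t ∈ x.1,
      |iteratedDerivWithin k (ext fun s => w.1 s j) S t
        - iteratedDerivWithin k (ext fun s => z.1 s j) S t| ≤ 1 / ((x.2 : ℝ) + 1) := by
    intro x
    obtain ⟨a, b, hab, hs, hx⟩ := hK x.1
    obtain ⟨w, hw, hwz⟩ := h a b hab hs (1 / ((x.2 : ℝ) + 1)) (by positivity)
    exact ⟨w, hw, fun j k hk t ht => hwz j k hk t (hx t ht)⟩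
  choose u huA hu using hu
  refine mem_closure_of_tendsto (f := u) (b := atTop) ?_ (Eventually.of_forall huA)
  have hind : IsInducing (fun (z : CmSpace S m q) (k : Fin (m + 1)) (j : Fin q) =>
      UniformOnFun.ofFun {K : Set S | IsCompact K}
        fun t : S => iteratedDerivWithin (k : ℕ) (ext fun s => z.1 s j) S t) := ⟨rfl⟩
  rw [hind.tendsto_nhds_iff, tendsto_pi_nhds]
  intro k
  rw [tendsto_pi_nhds]
  intro j
  rw [UniformOnFun.tendsto_iff_tendstoUniformlyOn]
  intro K hKc
  rw [Metric.tendstoUniformlyOn_iff]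
  intro ε hε
  obtain ⟨N, hN⟩ := exists_nat_one_div_lt hε
  filter_upwards [eventually_ge_atTop ((⟨K, hKc⟩, N) : TopologicalSpace.Compacts S × ℕ)]
    with x hx t ht
  rw [dist_comm, Real.dist_eq]
  refine (hu x j k (Nat.le_of_lt_succ k.2) t (hx.1 ht)).trans_lt (lt_of_le_of_lt ?_ hN)
  exact one_div_le_one_div_of_le (by positivity)
    (by have : (N : ℝ) ≤ x.2 := by exact_mod_cast hx.2
        linarith)

/-! ### Inclusion and density -/

section Density

variable {F : Type} [NormedAddCommGroup F] [InnerProductSpace ℝ F]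
  {q : ℕ} {ι : Type} [Fintype ι] {P : Matrix (Fin q) ι ℝ[X]} {Φ : ℝ → F} {r m : ℕ} {S : Set ℝ}

theorem inner_rowFeature_eq_sum_polyDiff (hΦ : ContDiff ℝ r Φ) (hP : opOrder P ≤ r)
    (G : PiLp 2 fun _ : ι => F) (j : Fin q) (t : ℝ) :
    inner ℝ G (rowFeature P Φ j t) = ∑ i, polyDiff (P j i) (fun s => inner ℝ (G i) (Φ s)) t := by
  rw [inner_rowFeature]
  exact Finset.sum_congr rfl fun i _ =>
    (polyDiff_inner hΦ ((natDegree_le_opOrder P j i).trans hP) (G i) t).symm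

/-- Since `H P = 0`, the functions `P(∂) f` with `f` represented by features are distributional
solutions of `H(∂) z = 0`. -/
theorem exists_mem_sol_eq_featureImage {n : ℕ} {H : Matrix (Fin n) (Fin q) ℝ[X]} (hHP : H * P = 0)
    (hΦ : ContDiff ℝ r Φ) (hm : m + opOrder P ≤ r) (G : PiLp 2 fun _ : ι => F) :
    ∃ w ∈ sol S m H, w.1 = featureImage S P Φ G := by
  refine ⟨⟨featureImage S P Φ G, contDiffOn_ext_featureImage S hΦ hm G⟩, ?_, rfl⟩
  intro φ hφ hc hs i
  have hP : opOrder P ≤ r := by omega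
  obtain ⟨R, hR⟩ := hc.isCompact.isBounded.subset_ball (0 : ℝ)
  rw [Real.ball_eq_Ioo] at hR
  let φ' : testFn (0 - R) (0 + R) := ⟨φ, mem_testFn_of_tsupport hφ hc hR⟩
  have hf : ∀ i, ContDiff ℝ r fun s => inner ℝ (G i) (Φ s) := fun i =>
    (innerSL ℝ (G i)).contDiff.comp hΦ
  have hw : ∀ j, Continuous fun t => inner ℝ G (rowFeature P Φ j t) := fun j =>
    (innerSL ℝ G).continuous.comp (contDiff_rowFeature hΦ hm j).continuous
  have h1 : polyAct (distrDeriv (0 - R) (0 + R)) P (fun i => ofFn _ _ ⟨_, (hf i).continuous⟩) =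
      fun j => ofFn _ _ ⟨_, hw j⟩ := by
    funext j
    simp only [polyAct]
    rw [Finset.sum_congr rfl fun i _ =>
      aeval_distrDeriv_ofFn (hf i) ((natDegree_le_opOrder P j i).trans hP), ← map_sum]
    congr 1
    ext t
    rw [ContinuousMap.sum_apply]
    exact (inner_rowFeature_eq_sum_polyDiff hΦ hP G j t).symm
  have h2 : polyAct (distrDeriv (0 - R) (0 + R)) H (fun j => ofFn _ _ ⟨_, hw j⟩) = 0 := by
    rw [← h1, ← polyAct_mul, hHP, polyAct_zero_left]
  have h3 := LinearMap.congr_fun (congrFun h2 i) φ'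
  simp only [polyAct, LinearMap.sum_apply, Pi.zero_apply, LinearMap.zero_apply] at h3
  rw [← h3]
  refine Finset.sum_congr rfl fun j _ => ?_
  rw [aeval_distrDeriv_apply, ofFn_apply, diffOp_univ, aeval_testDeriv]
  refine integral_congr_ae (ae_of_all _ fun t => ?_)
  by_cases ht : t ∈ tsupport φ
  · have htS : t ∈ S := interior_subset (hs ht)
    exact congrArg (· * polyDiff ((H i j).comp (-X)) φ t) (eqOn_ext_featureImage S G j htS)
  · have h0 : polyDiff ((H i j).comp (-X)) φ t = 0 := by
      rw [polyDiff_eqOn (isClosed_tsupport φ).isOpen_compl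
        (fun s hs => image_eq_zero_of_notMem_tsupport hs : EqOn φ (fun _ => 0) (tsupport φ)ᶜ) _ ht]
      simp [polyDiff, Polynomial.sum]
    simp only [φ', h0, mul_zero]

/-- If the features represent all smooth functions of compact support, the solutions represented by
features are dense. -/
theorem sol_subset_closure_featureImage {n : ℕ} {H : Matrix (Fin n) (Fin q) ℝ[X]}
    {Q : Matrix (Fin n) (Fin n) ℝ[X]} {V : Matrix (Fin q) (Fin q) ℝ[X]}
    {D : Matrix (Fin n) (Fin q) ℝ[X]} (hH : IsControllable H) (hD : IsSmithForm H Q V D)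
    (hS : S.OrdConnected) (hS' : S.Nontrivial) (hSu : UniqueDiffOn ℝ S) (hΦ : ContDiff ℝ r Φ)
    (hm : m + opOrder (parametrization V D) ≤ r)
    (hrep : ∀ f : ℝ → ℝ, ContDiff ℝ (⊤ : ℕ∞) f → HasCompactSupport f →
      ∃ g : F, ∀ t, inner ℝ g (Φ t) = f t) :
    sol S m H ⊆ closure {w | ∃ G, w.1 = featureImage S (parametrization V D) Φ G} := by
  intro z hz
  refine mem_closure_of_forall_Icc hS hS' fun a b hab hI ε hε => ?_
  obtain ⟨γ, hγ, hγc, happ⟩ := exists_polyDiff_approx_of_mem_sol hH hD hSu hz hab hI hε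
  choose g hg using fun i => hrep (γ i) (hγ i) (hγc i)
  let G : PiLp 2 fun _ : ZeroCol D => F := WithLp.toLp 2 g
  refine ⟨⟨featureImage S (parametrization V D) Φ G, contDiffOn_ext_featureImage S hΦ hm G⟩,
    ⟨G, rfl⟩, fun j k hk t ht => ?_⟩
  have h1 : ∀ t, inner ℝ G (rowFeature (parametrization V D) Φ j t) =
      ∑ i, polyDiff (parametrization V D j i) (γ i) t := fun t => by
    rw [inner_rowFeature_eq_sum_polyDiff hΦ (by omega)]
    exact Finset.sum_congr rfl fun i _ => by rw [← funext (hg i)]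
  rw [iteratedDerivWithin_ext_featureImage hSu hΦ hm G j hk (hI ht),
    ← iteratedDeriv_inner (contDiff_rowFeature hΦ (by omega) j), funext h1]
  exact happ j k hk t ht

/-- Every represented function can be approximated by functions represented by finite linear
combinations of features with times in `S`: the part of the representing element that is orthogonal
to these features does not matter. -/
theorem mem_closure_featureImage_span [CompleteSpace F] (hS : S.OrdConnected) (hS' : S.Nontrivial)
    (hSu : UniqueDiffOn ℝ S) (hΦ : ContDiff ℝ r Φ) (hm : m + opOrder P ≤ r) {w : CmSpace S m q}
    {G : PiLp 2 fun _ : ι => F} (hw : w.1 = featureImage S P Φ G) :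
    w ∈ closure {u : CmSpace S m q |
      ∃ G' ∈ Submodule.span ℝ (range fun x : S × Fin q => rowFeature P Φ x.2 x.1),
        u.1 = featureImage S P Φ G'} := by
  set N := Submodule.span ℝ (range fun x : S × Fin q => rowFeature P Φ x.2 x.1) with hN
  let G₁ : PiLp 2 fun _ : ι => F := N.topologicalClosure.starProjection G
  have hG₁ : G₁ ∈ closure (N : Set (PiLp 2 fun _ : ι => F)) :=
    Submodule.starProjection_apply_mem N.topologicalClosure G
  have hw₁ : w.1 = featureImage S P Φ G₁ := by
    rw [hw]
    funext t j
    have h1 : rowFeature P Φ j t ∈ N.topologicalClosure :=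
      N.le_topologicalClosure (Submodule.subset_span ⟨(t, j), rfl⟩)
    have h2 : inner ℝ (G - G₁) (rowFeature P Φ j t) = 0 :=
      N.topologicalClosure.starProjection_inner_eq_zero G _ h1
    rw [inner_sub_left, sub_eq_zero] at h2
    exact h2
  refine mem_closure_of_forall_Icc hS hS' fun a b hab hI ε hε => ?_
  -- a common bound for the derivatives of the features on the compact interval
  have hB : ∀ x : Fin q × Fin (m + 1), ∃ C, 0 ≤ C ∧
      ∀ t ∈ Icc a b, ‖iteratedDeriv x.2 (rowFeature P Φ x.1) t‖ ≤ C := by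
    intro x
    have hc : Continuous (iteratedDeriv x.2 (rowFeature P Φ x.1)) :=
      (contDiff_rowFeature hΦ (m := x.2) (by have := x.2.2; omega) x.1).continuous_iteratedDeriv' _
    obtain ⟨C, hC⟩ := isCompact_Icc.exists_bound_of_continuousOn hc.continuousOn
    exact ⟨C, (norm_nonneg _).trans (hC a (left_mem_Icc.mpr hab.le)), hC⟩
  choose C hC0 hC using hB
  have hK : 0 ≤ ∑ x, C x := Finset.sum_nonneg fun x _ => hC0 x
  obtain ⟨G', hG', hdist⟩ := Metric.mem_closure_iff.mp hG₁ (ε / (∑ x, C x + 1)) (by positivity)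
  refine ⟨⟨featureImage S P Φ G', contDiffOn_ext_featureImage S hΦ hm G'⟩, ⟨G', hG', rfl⟩,
    fun j k hk t ht => ?_⟩
  rw [hw₁, iteratedDerivWithin_ext_featureImage hSu hΦ hm G' j hk (hI ht),
    iteratedDerivWithin_ext_featureImage hSu hΦ hm G₁ j hk (hI ht), ← inner_sub_left]
  have h1 : ‖iteratedDeriv k (rowFeature P Φ j) t‖ ≤ ∑ x, C x + 1 :=
    ((hC (j, ⟨k, by omega⟩) t ht).trans
      (Finset.single_le_sum (fun x _ => hC0 x) (Finset.mem_univ _))).trans (by linarith)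
  calc |inner ℝ (G' - G₁) (iteratedDeriv k (rowFeature P Φ j) t)|
      ≤ ‖G' - G₁‖ * ‖iteratedDeriv k (rowFeature P Φ j) t‖ := abs_real_inner_le_norm _ _
    _ ≤ ε / (∑ x, C x + 1) * (∑ x, C x + 1) := by
        rw [← dist_eq_norm, dist_comm]
        exact mul_le_mul hdist.le h1 (norm_nonneg _) (by positivity)
    _ = ε := by field_simp

end Density

theorem uniqueDiffOn_of_ordConnected {S : Set ℝ} (hS : S.OrdConnected) (hS' : S.Nontrivial) :
    UniqueDiffOn ℝ S := by
  obtain ⟨a, ha, b, hb, hab⟩ := hS'.exists_lt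
  refine uniqueDiffOn_convex hS.convex ?_
  exact (nonempty_Ioo.mpr hab).mono
    (interior_maximal (Ioo_subset_Icc_self.trans (hS.out ha hb)) isOpen_Ioo)

end LodeGP

end

theorem theorem2
    -- the system `H`, controllable, with a Smith normal form `Q * H * V = D`
    {n q : ℕ} (H : Matrix (Fin n) (Fin q) (Polynomial ℝ)) (hH : LodeGP.IsControllable H)
    (Q : Matrix (Fin n) (Fin n) (Polynomial ℝ)) (V : Matrix (Fin q) (Fin q) (Polynomial ℝ))
    (D : Matrix (Fin n) (Fin q) (Polynomial ℝ)) (hD : LodeGP.IsSmithForm H Q V D)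
    -- the time domain: a non-degenerate interval
    (S : Set ℝ) (hS : S.OrdConnected) (hS' : S.Nontrivial)
    -- the Matérn kernel
    (σ ℓ : ℝ) (hσ : 0 < σ) (hℓ : 0 < ℓ) (r : ℕ) (ν : ℝ) (hν : ν = r + 1 / 2)
    (m : ℕ) (hm : (m : ℝ) + LodeGP.opOrder (LodeGP.parametrization V D) + 1 / 2 ≤ ν) :
    LodeGP.IsDenseIn
      (LodeGP.opImage S (LodeGP.parametrization V D) (LodeGP.matern σ ℓ r))
      (LodeGP.sol S m H) ∧
    ∀ v : ℝ, 0 < v →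
      LodeGP.IsDenseIn
        (LodeGP.posteriorMeans S
          (LodeGP.lodeKernel (LodeGP.parametrization V D) (LodeGP.matern σ ℓ r)) v)
        (LodeGP.sol S m H) := by
  have hSu := LodeGP.uniqueDiffOn_of_ordConnected hS hS'
  have hmr : m + LodeGP.opOrder (LodeGP.parametrization V D) ≤ r := by
    have h : (m : ℝ) + LodeGP.opOrder (LodeGP.parametrization V D) ≤ r := by linarith
    exact_mod_cast h
  have hP : LodeGP.opOrder (LodeGP.parametrization V D) ≤ r := by omega
  have hα : 0 < Real.sqrt (2 * r + 1) / ℓ := by positivity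
  have hΦ := LodeGP.contDiff_maternFeature σ hα r
  have hk := LodeGP.inner_maternFeature (σ := σ) hα (r := r) (ℓ := ℓ) rfl
  have hHP := LodeGP.mul_parametrization hD
  have hdense := LodeGP.sol_subset_closure_featureImage hH hD hS hS' hSu hΦ hmr
    fun _ => LodeGP.exists_inner_maternFeature_eq hσ hα r
  refine ⟨⟨fun w hw => ?_, ?_⟩, fun v hv => ⟨fun w hw => ?_, ?_⟩⟩
  · obtain ⟨G, rfl⟩ := (LodeGP.mem_opImage_iff hSu hΦ hP hk).mp hw
    exact LodeGP.exists_mem_sol_eq_featureImage hHP hΦ hmr G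
  · simpa only [LodeGP.mem_opImage_iff hSu hΦ hP hk] using hdense
  · obtain ⟨N, τ, c, rfl⟩ := (LodeGP.mem_posteriorMeans_iff S hΦ hP hk hv).mp hw
    exact LodeGP.exists_mem_sol_eq_featureImage hHP hΦ hmr _
  · refine hdense.trans (closure_minimal ?_ isClosed_closure)
    rintro w ⟨G, hw⟩
    refine closure_mono ?_ (LodeGP.mem_closure_featureImage_span hS hS' hSu hΦ hmr hw)
    rintro u ⟨G', hG', hu⟩
    obtain ⟨N, τ, c, rfl⟩ := LodeGP.exists_sum_eq_of_mem_span hG'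
    exact (LodeGP.mem_posteriorMeans_iff S hΦ hP hk hv).mpr ⟨N, τ, c, hu⟩
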